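/- Notation. For $g=(g_0,\dots,g_{n-1})\in\mathbb{R}^n$ let $C_g\in\mathbb{R}^{n\times n}$ be the circulant matrix $C_g(i,j)=g_{j-i}$ (indices modulo $n$). For $\xi\in\mathbb{R}^n$ let $D_\xi=\mathrm{Diag}(\xi)$. For an index set $\Omega\subseteq\{0,\dots,n-1\}$ with $|\Omega|=m$ let $R_\Omega$ be the restriction of vectors to the coordinates in $\Omega$. Put $\tilde A=R_\Omega C_g$ and $A=\tilde A D_\xi=R_\Omega C_g D_\xi$, with rows $a_i^T$, $i\in\Omega$. Setting. Let $g\sim\mathcal N(0,I_n)$ and let $\xi\in\{-1,1\}^n$ be a Rademacher sequence. Let $\Omega$, a unit vector $x^*\in\mathbb{R}^n$ and $v\in\mathbb{R}^n$ be fixed (deterministic). The observations are $b_i=\theta_i(\langle a_i,x^*\rangle)\in\{-1,1\}$, $i\in\Omega$, where the $\theta_i$ are i.i.d. copies of a random function $\theta$ of one of the following two kinds, with $\mathrm{sign}$ taking values in $\{-1,1\}$: (a) random bit flips: $\theta(z)=\tau\,\mathrm{sign}(z)$ with $\tau\in\{-1,1\}$ and $\mathbb P(\tau=-1)=p<\frac12$;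 (b) noise before quantization: $\theta(z)=\mathrm{sign}(z+e)$, where the distribution function $F_e$ of the real random variable $e$ satisfies $F_e(u)+F_e(-u)=1$ for all $u\in\mathbb R$. All the noise variables ($\tau_i$ or $e_i$), the coordinates of $g$ and the coordinates of $\xi$ are mutually independent. Let $\lambda=\mathbb E[\theta(z)z]$, where $z\sim\mathcal N(0,1)$ is independent of $\theta$. Statement (Lemma 10). For all constants $C_0,C_1>0$ there are constants $c,K>0$, depending only on $C_0$ and $C_1$, such that the following holds. Let $t>0$ satisfy $m\ge C_0(t+\log n)$, and let $\|x^*\|_\infty\le\rho$ with $\rho\le \frac{C_1}{m(t+\log m)}$. Then, with probability at least $1-e^{-ct}-e^{-c\sqrt m}$, $$\left|\left\langle \tfrac1m\tilde A^T b-\lambda D_\xi x^*,\; D_\xi v\right\rangle\right|\le K\,\|v\|_2\sqrt{\frac{t+\log n}{m}} .$$ -/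

import Mathlib

open MeasureTheory ProbabilityTheory Matrix

noncomputable section

/-- The quantizer `sign` with values in `{-1, +1}`; the value at `0` is `+1`. -/
def sgn (z : ℝ) : ℝ := if 0 ≤ z then 1 else -1

/-- The law of a Rademacher variable. -/
def rademacherLaw : Measure ℝ :=
  ENNReal.ofReal (1 / 2) • Measure.dirac 1 + ENNReal.ofReal (1 / 2) • Measure.dirac (-1)

/-- The law of a random flip `τ`: `-1` with probability `p` and `+1` with probability `1 - p`. -/
def flipLaw (p : ℝ) : Measure ℝ :=
  ENNReal.ofReal (1 - p) • Measure.dirac 1 + ENNReal.ofReal p • Measure.dirac (-1)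

/-- Random bit flips: `θ(z) = τ * sign z`. -/
def bitFlip (τ z : ℝ) : ℝ := τ * sgn z

/-- Random noise before quantization: `θ(z) = sign (z + e)`. -/
def noisySign (e z : ℝ) : ℝ := sgn (z + e)

/-- The admissible random functions `θ`, given as a function of the noise variable and of the
argument `z`, together with the law `ν` of the noise variable: either random bit flips with flip
probability `p < 1/2`, or additive noise before quantization whose distribution function
satisfies `F(x) + F(-x) = 1`. -/
def IsObservationModel (θ : ℝ → ℝ → ℝ) (ν : Measure ℝ) : Prop :=
  (θ = bitFlip ∧ ∃ p : ℝ, 0 ≤ p ∧ p < 1 / 2 ∧ ν = flipLaw p) ∨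
  (θ = noisySign ∧ IsProbabilityMeasure ν ∧ ∀ x : ℝ, cdf ν x + cdf ν (-x) = 1)

/-- `λ = E[θ(g) g]`, the expectation being over the noise in `θ` and an independent standard
normal variable `g`. -/
def obsMean (θ : ℝ → ℝ → ℝ) (ν : Measure ℝ) : ℝ :=
  ∫ q : ℝ × ℝ, θ q.1 q.2 * q.2 ∂(ν.prod (gaussianReal 0 1))

/-- The circulant matrix `C_g`, `C_g(i, j) = g_{j - i}` with `j - i` taken modulo `n`. -/
def circ {n : ℕ} (g : Fin n → ℝ) : Matrix (Fin n) (Fin n) ℝ :=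
  Matrix.of fun i j => g (j - i)

/-- The partial circulant matrix `Ã = R_Ω C_g`: the rows of `C_g` indexed by `Ω`. -/
def partialCirc {n : ℕ} (Ω : Finset (Fin n)) (g : Fin n → ℝ) : Matrix Ω (Fin n) ℝ :=
  (circ g).submatrix (fun i : Ω => (i : Fin n)) id

/-- The sensing matrix `A = R_Ω C_g D_ξ`. -/
def sensing {n : ℕ} (Ω : Finset (Fin n)) (g ξ : Fin n → ℝ) : Matrix Ω (Fin n) ℝ :=
  partialCirc Ω g * Matrix.diagonal ξ

/-- The observations `b_i = θ(⟨a_i, x⟩)`, where `a_i` is the `i`-th row of the sensing matrix and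
`w i` is the noise variable in the `i`-th use of `θ`. -/
def observations {n : ℕ} (θ : ℝ → ℝ → ℝ) (Ω : Finset (Fin n)) (g ξ : Fin n → ℝ) (w : Ω → ℝ)
    (x : Fin n → ℝ) : Ω → ℝ :=
  fun i => θ (w i) ((sensing Ω g ξ *ᵥ x) i)

/-- `⟨(1/m) Ãᵀ b - λ D_ξ x, D_ξ v⟩` with `m = |Ω|`. -/
def correlationError {n : ℕ} (θ : ℝ → ℝ → ℝ) (ν : Measure ℝ) (Ω : Finset (Fin n))
    (g ξ : Fin n → ℝ) (w : Ω → ℝ) (x v : Fin n → ℝ) : ℝ :=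
  ((1 / (Ω.card : ℝ)) • ((partialCirc Ω g)ᵀ *ᵥ observations θ Ω g ξ w x)
      - obsMean θ ν • (Matrix.diagonal ξ *ᵥ x)) ⬝ᵥ (Matrix.diagonal ξ *ᵥ v)

end

/-!
# Correlation of one-bit partial random circulant measurements with a fixed direction

By homogeneity `‖v‖ = 1`. Write `m = |Ω|` and let `p i` and `u i`, for `i ∈ Ω`, be the vectors with
`⟨g, p i⟩ = ⟨a_i, x⟩` and `⟨g, u i⟩ = ⟨a_i, v⟩`: cyclic shifts of `D_ξ x` and of `D_ξ v`
(`signedShift`). Then `m` times the quantity to be bounded is `∑ b_i ⟨g, u i⟩ - m λ ⟨x, v⟩`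
(`correlationError_eq`), where `b_i = θ_i(h_i)` and `h_i = ⟨g, p i⟩`. The proof conditions on the
signs `ξ`.

* *The signs.* For most `ξ` the inner products `⟨p i, p j⟩` and `⟨p i, u j⟩`, `i ≠ j`, which are
  Rademacher chaoses without diagonal, are at most `8 ρ √(τ + log m)`. With the bound on `ρ`, the
  Gram matrix `G` of the `p i` is within `1/4` of the identity in Frobenius norm, and the matrix `X`
  of the `⟨p i, u j⟩` within `1/4` of `⟨x, v⟩` times the identity. For most `ξ` also all Fourier
  coefficients of `D_ξ v` are of order `√ℓ`, with `ℓ = τ + log n`, so that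
  `∑ ⟨z, u i⟩² ≤ 8 ℓ ‖z‖²` for all `z` (`sum_correlation_sq_le`).

* *Change of measure.* The `h_i` are correlated, but only slightly. The law of `g` is compared with
  that of a Gaussian vector for which the `h_i` are exactly independent and standard
  (`lintegral_stdGaussian_le_of_gram`). The density is bounded in `L²` by a constant, so
  probabilities are at worst replaced by twice their square root.

* *Independent observations.* Once the `h_i` are independent, so are the pairs `(h_i, b_i)`, and
  each `b_i` is an unbiased sign, by the symmetry of `sign` or of the noise
  (`exists_sign_of_isObservationModel`). Expanding `g` in the dual family of the `p i`, with a
  residual `R z` orthogonal to them, and putting `N = G⁻¹ X`, the sum `∑ b_i ⟨g, u i⟩` splits into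
  the diagonal part `∑ N_ii b_i h_i`, a sum of independent variables, subgaussian once centred; the
  chaos `∑ N_ji b_i h_j`, `i ≠ j`, treated by decoupling; and `∑ b_i ⟨R z, u i⟩` with `z` Gaussian
  and independent of the signs, where integrating the signs first leaves the exponential moment of a
  Gaussian quadratic form controlled by `8 ℓ` (`reference_tail_le`). The mean `λ tr N` differs from
  `m λ ⟨x, v⟩` by at most `1`: the diagonals of `G` and `X` are exact, so the trace sees the
  perturbation only to second order (`inverse_mul_sub_small`).

* *The exponent.* The Chernoff parameter has to stay below order `1/√ℓ`, so a deviation of order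
  `√(m ℓ)` cannot be given a probability smaller than about `e^{-√m}` in this way. Hence the
  argument is run with `τ = min (t + 3) √m`, which produces the term `e^{-c√m}`
  (`conditional_tail_le_exp`, `joint_tail_le`).

When `m` is below a constant depending on `C₁`, the inequality `m ≥ C₀ (t + log n)` bounds `t`, and
the claim is made trivial by the choice of `c`.
-/

/-! ### Exponential moments as lower Lebesgue integrals -/

/-- The exponential with values in `[0, ∞]`. Exponential moments are written with it as lower
Lebesgue integrals, so that no integrability has to be checked. -/
noncomputable def eexp (x : ℝ) : ENNReal := ENNReal.ofReal (Real.exp x)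

@[fun_prop]
lemma measurable_eexp : Measurable eexp := by unfold eexp; fun_prop

lemma eexp_add (x y : ℝ) : eexp (x + y) = eexp x * eexp y := by
  unfold eexp
  rw [Real.exp_add, ENNReal.ofReal_mul (Real.exp_nonneg _)]

lemma eexp_sum {ι : Type*} (s : Finset ι) (f : ι → ℝ) :
    eexp (∑ i ∈ s, f i) = ∏ i ∈ s, eexp (f i) := by
  unfold eexp
  rw [Real.exp_sum, ENNReal.ofReal_prod_of_nonneg fun _ _ => Real.exp_nonneg _]

lemma eexp_le_eexp {x y : ℝ} (h : x ≤ y) : eexp x ≤ eexp y :=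
  ENNReal.ofReal_le_ofReal (Real.exp_le_exp.2 h)

lemma eexp_zero : eexp 0 = 1 := by simp [eexp]

lemma eexp_ne_top (x : ℝ) : eexp x ≠ ⊤ := by simp [eexp]

lemma eexp_mul_eexp_neg (x : ℝ) : eexp x * eexp (-x) = 1 := by
  rw [← eexp_add, add_neg_cancel, eexp_zero]

lemma lintegral_pi_prod {ι : Type*} [Fintype ι] {Ω : ι → Type*} [∀ i, MeasurableSpace (Ω i)]
    (μ : ∀ i, Measure (Ω i)) [∀ i, IsProbabilityMeasure (μ i)] (f : ∀ i, Ω i → ENNReal)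
    (hf : ∀ i, Measurable (f i)) :
    ∫⁻ x, ∏ i, f i (x i) ∂(Measure.pi μ) = ∏ i, ∫⁻ y, f i y ∂(μ i) := by
  have h := lintegral_prod_eq_prod_lintegral_of_indepFun (μ := Measure.pi μ) Finset.univ
    (fun i x => f i (x i)) (iIndepFun_pi (X := f) fun i => (hf i).aemeasurable)
    (fun i => (hf i).comp (measurable_pi_apply i))
  rw [h]
  exact Finset.prod_congr rfl fun i _ =>
    (measurePreserving_eval μ i).lintegral_comp (hf i)

/-- Chernoff's bound. -/
lemma measure_le_eexp_mul_lintegral {α : Type*} [MeasurableSpace α] (μ : Measure α) {f : α → ℝ}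
    (hf : Measurable f) {s : ℝ} (hs : 0 ≤ s) (y : ℝ) :
    μ {x | y ≤ f x} ≤ eexp (-(s * y)) * ∫⁻ x, eexp (s * f x) ∂μ := by
  have h1 : {x | y ≤ f x} ⊆ {x | eexp (s * y) ≤ eexp (s * f x)} := fun x hx =>
    eexp_le_eexp (mul_le_mul_of_nonneg_left hx hs)
  have h2 := mul_meas_ge_le_lintegral (μ := μ) (f := fun x => eexp (s * f x))
    (by fun_prop) (eexp (s * y))
  calc μ {x | y ≤ f x} ≤ μ {x | eexp (s * y) ≤ eexp (s * f x)} := measure_mono h1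
    _ = eexp (-(s * y)) * (eexp (s * y) * μ {x | eexp (s * y) ≤ eexp (s * f x)}) := by
      rw [← mul_assoc, mul_comm (eexp (-(s * y))), eexp_mul_eexp_neg, one_mul]
    _ ≤ _ := by gcongr

lemma measure_abs_le_eexp_mul_lintegral {α : Type*} [MeasurableSpace α] (μ : Measure α)
    {f : α → ℝ} (hf : Measurable f) {s : ℝ} (hs : 0 ≤ s) (y : ℝ) {B : ENNReal}
    (h1 : ∫⁻ x, eexp (s * f x) ∂μ ≤ B) (h2 : ∫⁻ x, eexp (-s * f x) ∂μ ≤ B) :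
    μ {x | y ≤ |f x|} ≤ 2 * (eexp (-(s * y)) * B) := by
  have h : {x | y ≤ |f x|} ⊆ {x | y ≤ f x} ∪ {x | y ≤ -f x} := fun x hx => by
    simpa [le_abs] using hx
  calc μ {x | y ≤ |f x|} ≤ μ {x | y ≤ f x} + μ {x | y ≤ -f x} :=
        (measure_mono h).trans (measure_union_le _ _)
    _ ≤ eexp (-(s * y)) * B + eexp (-(s * y)) * B := by
      gcongr
      · exact (measure_le_eexp_mul_lintegral μ hf hs y).trans (by gcongr)
      · refine (measure_le_eexp_mul_lintegral μ hf.neg hs y).trans ?_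
        gcongr
        simpa [neg_mul] using h2
    _ = _ := by ring

/-- A random sign of mean zero has the exponential moments `cosh a ≤ exp (a ^ 2 / 2)`. -/
lemma lintegral_eexp_sign_le {α : Type*} [MeasurableSpace α] (μ : Measure α)
    [IsProbabilityMeasure μ] {b : α → ℝ} (hb : Measurable b) (hb1 : ∀ x, b x = 1 ∨ b x = -1)
    (hb0 : ∫ x, b x ∂μ = 0) (a : ℝ) :
    ∫⁻ x, eexp (a * b x) ∂μ ≤ eexp (a ^ 2 / 2) := by
  have h : ∀ x, Real.exp (a * b x) = Real.cosh a + b x * Real.sinh a := by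
    intro x
    rcases hb1 x with h | h <;> simp [h, ← Real.cosh_sub_sinh, sub_eq_add_neg]
  have hi : Integrable b μ := by
    refine Integrable.of_bound hb.aestronglyMeasurable 1 (.of_forall fun x => ?_)
    rcases hb1 x with h | h <;> simp [h]
  have hi2 : Integrable (fun x => Real.exp (a * b x)) μ := by
    simp_rw [h]
    exact (integrable_const _).add (hi.mul_const _)
  unfold eexp
  rw [← ofReal_integral_eq_lintegral_ofReal hi2 (.of_forall fun _ => Real.exp_nonneg _)]
  simp_rw [h]
  rw [integral_add (integrable_const _) (hi.mul_const _), integral_mul_const, hb0]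
  simpa using ENNReal.ofReal_le_ofReal (Real.cosh_le_exp_half_sq a)

lemma lintegral_eexp_mul_gaussianReal (a : ℝ) :
    ∫⁻ x, eexp (a * x) ∂(gaussianReal 0 1) = eexp (a ^ 2 / 2) := by
  unfold eexp
  rw [← ofReal_integral_eq_lintegral_ofReal (integrable_exp_mul_gaussianReal a)
    (.of_forall fun _ => Real.exp_nonneg _)]
  have := congrFun (mgf_id_gaussianReal (μ := 0) (v := 1)) a
  simp only [mgf, id] at this
  rw [this]
  simp

lemma lintegral_eexp_sq_gaussianReal {κ : ℝ} (hκ : κ < 1 / 2) :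
    ∫⁻ x, eexp (κ * x ^ 2) ∂(gaussianReal 0 1) = ENNReal.ofReal ((√(1 - 2 * κ))⁻¹) := by
  rw [gaussianReal_of_var_ne_zero 0 one_ne_zero,
    lintegral_withDensity_eq_lintegral_mul _ (measurable_gaussianPDF 0 1) (by fun_prop)]
  have hp : 0 < 1 / 2 - κ := by linarith
  have h1 : ∀ x : ℝ, (gaussianPDF 0 1 * fun x => eexp (κ * x ^ 2)) x
      = ENNReal.ofReal ((√(2 * Real.pi))⁻¹ * Real.exp (-(1 / 2 - κ) * x ^ 2)) := by
    intro x
    simp only [Pi.mul_apply, gaussianPDF, gaussianPDFReal, eexp]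
    rw [← ENNReal.ofReal_mul (by positivity), mul_assoc, ← Real.exp_add]
    simp only [NNReal.coe_one, mul_one, sub_zero]
    congr 3
    ring
  simp_rw [h1]
  rw [← ofReal_integral_eq_lintegral_ofReal ((integrable_exp_neg_mul_sq hp).const_mul _)
    (.of_forall fun _ => by positivity), integral_const_mul, integral_gaussian]
  congr 1
  rw [← Real.sqrt_inv, ← Real.sqrt_inv, ← Real.sqrt_mul (by positivity)]
  congr 1
  have : 1 - 2 * κ ≠ 0 := by linarith
  field_simp

lemma inv_sqrt_one_sub_le_exp {x : ℝ} (h0 : 0 ≤ x) (h1 : x ≤ 1 / 2) :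
    (√(1 - x))⁻¹ ≤ Real.exp x := by
  have h2 : Real.exp (-(2 * x)) ≤ 1 - x := by
    have h3 := Real.add_one_le_exp (2 * x)
    rw [Real.exp_neg]
    have : (1 : ℝ) ≤ (1 - x) * (2 * x + 1) := by nlinarith
    rw [inv_le_iff_one_le_mul₀ (Real.exp_pos _)]
    nlinarith
  have h4 : Real.exp (-x) ≤ √(1 - x) := by
    apply Real.le_sqrt_of_sq_le
    rw [← Real.exp_nat_mul]
    convert h2 using 2
    push_cast
    ring
  rw [inv_le_comm₀ (lt_of_lt_of_le (Real.exp_pos _) h4) (Real.exp_pos _), ← Real.exp_neg]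
  exact h4

lemma lintegral_eexp_sq_gaussianReal_le {κ : ℝ} (h0 : 0 ≤ κ) (hκ : κ ≤ 1 / 4) :
    ∫⁻ x, eexp (κ * x ^ 2) ∂(gaussianReal 0 1) ≤ eexp (2 * κ) := by
  rw [lintegral_eexp_sq_gaussianReal (by linarith)]
  exact ENNReal.ofReal_le_ofReal (inv_sqrt_one_sub_le_exp (by linarith) (by linarith))

/-! ### Decoupling of quadratic forms in independent variables -/

/-- Splicing two independent copies of a family of independent variables along a set of indices
does not change its law. -/
lemma measurePreserving_splice {ι S : Type*} [Fintype ι] [MeasurableSpace S]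
    (μ : Measure S) [IsProbabilityMeasure μ] (ε : ι → Bool) :
    MeasurePreserving (fun p : (ι → S) × (ι → S) => fun i => if ε i then p.1 i else p.2 i)
      ((Measure.pi fun _ => μ).prod (Measure.pi fun _ => μ)) (Measure.pi fun _ => μ) := by
  have hm : Measurable (fun p : (ι → S) × (ι → S) => fun i => if ε i then p.1 i else p.2 i) := by
    refine measurable_pi_lambda _ fun i => ?_
    by_cases h : ε i <;> simp only [h, if_true, if_false, Bool.false_eq_true] <;> fun_prop
  refine ⟨hm, (Measure.pi_eq fun s hs => ?_).symm⟩
  rw [Measure.map_apply hm (MeasurableSet.univ_pi hs)]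
  have : (fun p : (ι → S) × (ι → S) => fun i => if ε i then p.1 i else p.2 i) ⁻¹'
      Set.univ.pi s = (Set.univ.pi fun i => if ε i then s i else Set.univ) ×ˢ
        (Set.univ.pi fun i => if ε i then Set.univ else s i) := by
    ext p
    simp only [Set.mem_preimage, Set.mem_pi, Set.mem_univ, true_implies, Set.mem_prod,
      ← forall_and]
    refine forall_congr' fun i => ?_
    by_cases h : ε i <;> simp [h]
  rw [this, Measure.prod_prod, Measure.pi_pi, Measure.pi_pi, ← Finset.prod_mul_distrib]
  refine Finset.prod_congr rfl fun i _ => ?_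
  by_cases h : ε i <;> simp [h]

/-- Exactly a quarter of all subsets contain `i` and avoid `j`. -/
lemma four_mul_sum_separating {ι : Type*} [Fintype ι] [DecidableEq ι] {i j : ι} (hij : i ≠ j) :
    4 * ∑ ε : ι → Bool, (if ε i ∧ ¬ ε j then (1 : ℝ) else 0) = Fintype.card (ι → Bool) := by
  let flip (k : ι) : (ι → Bool) ≃ (ι → Bool) :=
    Function.Involutive.toPerm (fun ε => Function.update ε k (!ε k)) fun ε => by simp
  let f (ε : ι → Bool) : ℝ := if ε i ∧ ¬ ε j then 1 else 0
  have h1 : ∑ ε, f (flip i ε) = ∑ ε, f ε := (flip i).sum_comp f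
  have h2 : ∑ ε, f (flip j ε) = ∑ ε, f ε := (flip j).sum_comp f
  have h3 : ∑ ε, f (flip j (flip i ε)) = ∑ ε, f ε := ((flip i).trans (flip j)).sum_comp f
  have h4 : ∀ ε, f ε + f (flip i ε) + f (flip j ε) + f (flip j (flip i ε)) = 1 := by
    intro ε
    have e1 : ∀ k (ε' : ι → Bool), flip k ε' = Function.update ε' k (!ε' k) := fun _ _ => rfl
    simp only [f, e1, Function.update_self, Function.update_of_ne hij,
      Function.update_of_ne hij.symm]
    cases ε i <;> cases ε j <;> simp
  have h5 : ∑ ε, (f ε + f (flip i ε) + f (flip j ε) + f (flip j (flip i ε)))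
      = Fintype.card (ι → Bool) := by
    simp [h4]
  rw [Finset.sum_add_distrib, Finset.sum_add_distrib, Finset.sum_add_distrib, h1, h2, h3] at h5
  change 4 * ∑ ε, f ε = _
  linarith

/-- Jensen's inequality over a uniformly random subset: the quadratic form is the average of four
times its restrictions to `T × Tᶜ`. -/
lemma eexp_sum_le_average {ι : Type*} [Fintype ι] [DecidableEq ι] (A : ι → ι → ℝ)
    (hA : ∀ i, A i i = 0) :
    eexp (∑ i, ∑ j, A i j) ≤ ∑ ε : ι → Bool, ENNReal.ofReal ((Fintype.card (ι → Bool) : ℝ)⁻¹) *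
      eexp (4 * ∑ i, ∑ j, if ε i ∧ ¬ ε j then A i j else 0) := by
  set N : ℝ := (Fintype.card (ι → Bool) : ℝ) with hNdef
  have hN : 0 < N := by rw [hNdef]; exact_mod_cast Fintype.card_pos
  have key : ∑ ε : ι → Bool, N⁻¹ * (4 * ∑ i, ∑ j, if ε i ∧ ¬ ε j then A i j else 0)
      = ∑ i, ∑ j, A i j := by
    have h : ∀ i j, ∑ ε : ι → Bool, N⁻¹ * (4 * if ε i ∧ ¬ ε j then A i j else 0) = A i j := by
      intro i j
      by_cases hij : i = j
      · subst hij; simp [hA]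
      · have h1 := four_mul_sum_separating hij
        have h2 : ∀ ε : ι → Bool, N⁻¹ * (4 * if ε i ∧ ¬ ε j then A i j else 0)
            = N⁻¹ * A i j * (4 * if ε i ∧ ¬ ε j then 1 else 0) := by
          intro ε; split_ifs <;> ring
        simp_rw [h2]
        rw [← Finset.mul_sum, ← Finset.mul_sum, h1]
        change N⁻¹ * A i j * N = _
        field_simp
    simp_rw [Finset.mul_sum]
    rw [Finset.sum_comm]
    refine Finset.sum_congr rfl fun i _ => ?_
    rw [Finset.sum_comm]
    exact Finset.sum_congr rfl fun j _ => h i j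
  have hJ := convexOn_exp.map_sum_le (t := (Finset.univ : Finset (ι → Bool)))
    (w := fun _ => N⁻¹)
    (p := fun ε => 4 * ∑ i, ∑ j, if ε i ∧ ¬ ε j then A i j else 0)
    (fun _ _ => by positivity) (by simp [N]) (fun _ _ => Set.mem_univ _)
  simp only [smul_eq_mul] at hJ
  rw [key] at hJ
  refine (ENNReal.ofReal_le_ofReal hJ).trans ?_
  rw [ENNReal.ofReal_sum_of_nonneg fun _ _ => by positivity]
  refine Finset.sum_le_sum fun ε _ => ?_
  rw [ENNReal.ofReal_mul (by positivity)]
  rfl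

/-- Decoupling: after restriction to `T × Tᶜ` the factors `φ (x i)` and `ψ (x j)` of a quadratic
form without diagonal are independent, so that a subgaussian `φ` can be integrated out first. -/
theorem lintegral_eexp_quadratic_le {ι S : Type*} [Fintype ι] [DecidableEq ι] [MeasurableSpace S]
    (μ : Measure S) [IsProbabilityMeasure μ] {φ ψ : S → ℝ} (hφ : Measurable φ)
    (hψ : Measurable ψ) (hsub : ∀ a, ∫⁻ x, eexp (a * φ x) ∂μ ≤ eexp (a ^ 2 / 2))
    (c : ι → ι → ℝ) (hc : ∀ i, c i i = 0) {B : ENNReal}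
    (hB : ∀ ε : ι → Bool,
      ∫⁻ x, eexp (8 * ∑ i, (∑ j, if ε i ∧ ¬ ε j then c i j * ψ (x j) else 0) ^ 2)
      ∂(Measure.pi fun _ => μ) ≤ B) :
    ∫⁻ x, eexp (∑ i, ∑ j, c i j * φ (x i) * ψ (x j)) ∂(Measure.pi fun _ : ι => μ) ≤ B := by
  have hone : ∀ ε : ι → Bool,
      ∫⁻ x, eexp (4 * ∑ i, ∑ j, if ε i ∧ ¬ ε j then c i j * φ (x i) * ψ (x j) else 0)
        ∂(Measure.pi fun _ : ι => μ) ≤ B := by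
    intro ε
    have hms : Measurable fun x : ι → S =>
        eexp (4 * ∑ i, ∑ j, if ε i ∧ ¬ ε j then c i j * φ (x i) * ψ (x j) else 0) := by
      refine measurable_eexp.comp (Measurable.const_mul ?_ _)
      refine Finset.measurable_sum _ fun i _ => Finset.measurable_sum _ fun j _ => ?_
      split_ifs <;> fun_prop
    rw [← (measurePreserving_splice μ ε).lintegral_comp hms]
    have heq : ∀ p : (ι → S) × (ι → S),
        4 * ∑ i, ∑ j, (if ε i ∧ ¬ ε j then c i j * φ (if ε i then p.1 i else p.2 i) *
          ψ (if ε j then p.1 j else p.2 j) else 0)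
        = ∑ i, (4 * ∑ j, if ε i ∧ ¬ ε j then c i j * ψ (p.2 j) else 0) * φ (p.1 i) := by
      intro p
      rw [Finset.mul_sum]
      refine Finset.sum_congr rfl fun i _ => ?_
      rw [mul_assoc, Finset.sum_mul]
      congr 1
      refine Finset.sum_congr rfl fun j _ => ?_
      by_cases h : ε i ∧ ¬ ε j
      · simp only [h, if_true, not_false_eq_true, and_self, if_false, Bool.false_eq_true]
        ring
      · simp only [h, if_false, zero_mul]
    simp_rw [heq]
    have hm2 : ∀ i, Measurable fun x : ι → S =>
        4 * ∑ j, if ε i ∧ ¬ ε j then c i j * ψ (x j) else 0 := by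
      intro i
      refine Measurable.const_mul (Finset.measurable_sum _ fun j _ => ?_) _
      split_ifs <;> fun_prop
    rw [lintegral_prod_symm]
    · refine le_trans (lintegral_mono fun x' => ?_) (hB ε)
      simp only [eexp_sum]
      rw [lintegral_pi_prod (fun _ => μ)
        (fun i y => eexp ((4 * ∑ j, if ε i ∧ ¬ ε j then c i j * ψ (x' j) else 0) * φ y))
        (fun i => by fun_prop)]
      rw [Finset.mul_sum, eexp_sum]
      refine Finset.prod_le_prod' fun i _ => (hsub _).trans (eexp_le_eexp (le_of_eq ?_))
      ring
    · refine (measurable_eexp.comp (Finset.measurable_sum _ fun i _ => ?_)).aemeasurable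
      exact ((hm2 i).comp measurable_snd).mul (by fun_prop)
  calc ∫⁻ x, eexp (∑ i, ∑ j, c i j * φ (x i) * ψ (x j)) ∂(Measure.pi fun _ : ι => μ)
      ≤ ∫⁻ x, ∑ ε : ι → Bool, ENNReal.ofReal ((Fintype.card (ι → Bool) : ℝ)⁻¹) *
          eexp (4 * ∑ i, ∑ j, if ε i ∧ ¬ ε j then c i j * φ (x i) * ψ (x j) else 0)
          ∂(Measure.pi fun _ : ι => μ) :=
        lintegral_mono fun x => eexp_sum_le_average (fun i j => c i j * φ (x i) * ψ (x j))
          fun i => by simp [hc]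
    _ = ∑ ε : ι → Bool, ENNReal.ofReal ((Fintype.card (ι → Bool) : ℝ)⁻¹) *
          ∫⁻ x, eexp (4 * ∑ i, ∑ j, if ε i ∧ ¬ ε j then c i j * φ (x i) * ψ (x j) else 0)
          ∂(Measure.pi fun _ : ι => μ) := by
        have hms : ∀ ε : ι → Bool, Measurable fun x : ι → S =>
            eexp (4 * ∑ i, ∑ j, if ε i ∧ ¬ ε j then c i j * φ (x i) * ψ (x j) else 0) := by
          intro ε
          refine measurable_eexp.comp (Measurable.const_mul ?_ _)
          refine Finset.measurable_sum _ fun i _ => Finset.measurable_sum _ fun j _ => ?_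
          split_ifs <;> fun_prop
        rw [lintegral_finsetSum _ fun ε _ => (hms ε).const_mul _]
        exact Finset.sum_congr rfl fun ε _ => lintegral_const_mul _ (hms ε)
    _ ≤ ∑ ε : ι → Bool, ENNReal.ofReal ((Fintype.card (ι → Bool) : ℝ)⁻¹) * B := by
        gcongr with ε
        exact hone ε
    _ = B := by
        rw [← Finset.sum_mul, ← ENNReal.ofReal_sum_of_nonneg fun _ _ => by positivity]
        simp

/-! ### Exponential moments of Gaussian vectors -/

section GaussianVector

variable {E : Type*} [NormedAddCommGroup E] [InnerProductSpace ℝ E] [FiniteDimensional ℝ E]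
  [MeasurableSpace E] [BorelSpace E]

lemma lintegral_stdGaussian {ι : Type*} [Fintype ι] (b : OrthonormalBasis ι ℝ E)
    {f : E → ENNReal} (hf : Measurable f) :
    ∫⁻ z, f z ∂(stdGaussian E)
      = ∫⁻ x, f (∑ i, x i • b i) ∂(Measure.pi fun _ : ι => gaussianReal 0 1) := by
  rw [stdGaussian_eq_map_pi_orthonormalBasis b, lintegral_map hf (by fun_prop)]

lemma lintegral_eexp_inner_stdGaussian (u : E) :
    ∫⁻ z, eexp (inner ℝ z u) ∂(stdGaussian E) = eexp (‖u‖ ^ 2 / 2) := by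
  set b := stdOrthonormalBasis ℝ E
  rw [lintegral_stdGaussian b (by fun_prop)]
  have h : ∀ x : Fin (Module.finrank ℝ E) → ℝ,
      eexp (inner ℝ (∑ i, x i • b i) u) = ∏ i, eexp (inner ℝ (b i) u * x i) := by
    intro x
    rw [sum_inner, eexp_sum]
    refine Finset.prod_congr rfl fun i _ => ?_
    rw [real_inner_smul_left, mul_comm]
  simp_rw [h]
  rw [lintegral_pi_prod (fun _ => gaussianReal 0 1) (fun i y => eexp (inner ℝ (b i) u * y))
    (fun i => by fun_prop)]
  simp_rw [lintegral_eexp_mul_gaussianReal]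
  rw [← eexp_sum, ← Finset.sum_div]
  congr 2
  simpa [Real.norm_eq_abs, sq_abs] using b.sum_sq_norm_inner_right u

/-- Exponential moment of a Gaussian quadratic form with operator norm at most `L` and trace
`∑ i, ‖u i‖ ^ 2`, from its diagonalization. -/
theorem lintegral_eexp_sum_inner_sq_le {κ : Type*} [Fintype κ] (u : κ → E) {s L : ℝ}
    (hs : 0 ≤ s) (hL : ∀ z, ∑ i, inner ℝ z (u i) ^ 2 ≤ L * ‖z‖ ^ 2) (hsL : s * L ≤ 1 / 4) :
    ∫⁻ z, eexp (s * ∑ i, inner ℝ z (u i) ^ 2) ∂(stdGaussian E)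
      ≤ eexp (2 * s * ∑ i, ‖u i‖ ^ 2) := by
  let T : E →ₗ[ℝ] E := ∑ i, ((innerSL ℝ (u i)).smulRight (u i) : E →ₗ[ℝ] E)
  have hT : ∀ z, T z = ∑ i, inner ℝ (u i) z • u i := by
    intro z; simp [T, LinearMap.sum_apply]
  have hTi : ∀ z y, inner ℝ (T z) y = ∑ i, inner ℝ z (u i) * inner ℝ y (u i) := by
    intro z y
    rw [hT, sum_inner]
    refine Finset.sum_congr rfl fun i _ => ?_
    rw [real_inner_smul_left, real_inner_comm z, real_inner_comm y]
  have hsymm : T.IsSymmetric := by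
    intro z y
    rw [hTi, real_inner_comm, hTi]
    exact Finset.sum_congr rfl fun i _ => mul_comm _ _
  let b := hsymm.eigenvectorBasis rfl
  let μ : Fin (Module.finrank ℝ E) → ℝ := hsymm.eigenvalues rfl
  have hTb : ∀ k, T (b k) = μ k • b k := fun k => hsymm.apply_eigenvectorBasis rfl k
  have hμ : ∀ k, ∑ i, inner ℝ (b k) (u i) ^ 2 = μ k := by
    intro k
    have h1 := hTi (b k) (b k)
    rw [hTb, real_inner_smul_left, real_inner_self_eq_norm_sq, b.norm_eq_one] at h1
    simp_rw [sq]
    linarith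
  have hμ0 : ∀ k, 0 ≤ μ k := fun k => by rw [← hμ]; positivity
  have hμL : ∀ k, μ k ≤ L := fun k => by
    rw [← hμ]; simpa [b.norm_eq_one] using hL (b k)
  have htr : ∑ k, μ k = ∑ i, ‖u i‖ ^ 2 := by
    simp_rw [← hμ]
    rw [Finset.sum_comm]
    refine Finset.sum_congr rfl fun i _ => ?_
    simpa [Real.norm_eq_abs, sq_abs] using b.sum_sq_norm_inner_right (u i)
  rw [lintegral_stdGaussian b (by fun_prop)]
  have hq : ∀ x : Fin (Module.finrank ℝ E) → ℝ,
      s * ∑ i, inner ℝ (∑ k, x k • b k) (u i) ^ 2 = ∑ k, s * μ k * x k ^ 2 := by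
    intro x
    have h1 := hTi (∑ k, x k • b k) (∑ k, x k • b k)
    simp_rw [sq, ← h1, map_sum, map_smul, hTb]
    rw [sum_inner, Finset.mul_sum]
    refine Finset.sum_congr rfl fun k _ => ?_
    rw [real_inner_smul_left, real_inner_smul_left, inner_sum, Finset.sum_eq_single k]
    · rw [real_inner_smul_right, real_inner_self_eq_norm_sq, b.norm_eq_one]
      ring
    · intro l _ hl
      rw [real_inner_smul_right, b.inner_eq_zero hl.symm, mul_zero]
    · simp
  simp_rw [hq, eexp_sum]
  rw [lintegral_pi_prod (fun _ => gaussianReal 0 1) (fun k y => eexp (s * μ k * y ^ 2))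
    (fun k => by fun_prop), ← htr, Finset.mul_sum, eexp_sum]
  refine Finset.prod_le_prod' fun k _ => ?_
  refine (lintegral_eexp_sq_gaussianReal_le (mul_nonneg hs (hμ0 k)) ?_).trans
    (eexp_le_eexp (le_of_eq (by ring)))
  exact (mul_le_mul_of_nonneg_left (hμL k) hs).trans hsL

end GaussianVector

/-! ### Change of measure between Gaussian vectors -/

/-- The density of the centred normal law of variance `1 + d` with respect to the standard one. -/
noncomputable def gaussianRatio (d : ℝ) (x : ℝ) : ENNReal :=
  ENNReal.ofReal (√(1 + d))⁻¹ * eexp (d / (2 * (1 + d)) * x ^ 2)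

lemma measurable_gaussianRatio (d : ℝ) : Measurable (gaussianRatio d) := by
  unfold gaussianRatio; fun_prop

lemma gaussianReal_map_sqrt_mul {d : ℝ} (hd : -1 < d) :
    (gaussianReal 0 1).map (fun x => √(1 + d) * x)
      = (gaussianReal 0 1).withDensity (gaussianRatio d) := by
  have h1 : 0 < 1 + d := by linarith
  rw [gaussianReal_map_const_mul]
  have hv : NNReal.mk (√(1 + d) ^ 2) (sq_nonneg _) * 1 ≠ 0 := by
    rw [mul_one, ← NNReal.coe_ne_zero]
    exact (pow_pos (Real.sqrt_pos.2 h1) 2).ne'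
  rw [gaussianReal_of_var_ne_zero _ hv, gaussianReal_of_var_ne_zero 0 one_ne_zero,
    ← withDensity_mul _ (measurable_gaussianPDF 0 1) (measurable_gaussianRatio d)]
  congr 1
  ext x
  simp only [Pi.mul_apply, gaussianPDF, gaussianPDFReal, gaussianRatio, eexp]
  rw [← ENNReal.ofReal_mul (by positivity), ← ENNReal.ofReal_mul (by positivity)]
  congr 1
  have e1 : ((NNReal.mk (√(1 + d) ^ 2) (sq_nonneg _) * 1 : NNReal) : ℝ) = 1 + d := by
    rw [mul_one]
    exact Real.sq_sqrt h1.le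
  rw [e1, NNReal.coe_one, Real.sqrt_mul (by positivity)]
  rw [mul_inv, mul_one, mul_assoc, mul_assoc, mul_left_comm (Real.exp _), ← Real.exp_add]
  congr 3
  simp only [mul_zero, sub_zero, mul_one]
  field_simp
  ring

/-- The second moment of `gaussianRatio d` is `(1 - d ^ 2) ^ (-1 / 2)`. -/
lemma lintegral_gaussianRatio_sq_le {d : ℝ} (hd : d ^ 2 ≤ 1 / 16) :
    ∫⁻ x, gaussianRatio d x ^ 2 ∂(gaussianReal 0 1) ≤ eexp (d ^ 2) := by
  have hd1 : -(1 / 4) ≤ d := by nlinarith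
  have hd2 : d ≤ 1 / 4 := by nlinarith
  have h1 : 0 < 1 + d := by linarith
  have h : ∀ x, gaussianRatio d x ^ 2
      = ENNReal.ofReal (1 + d)⁻¹ * eexp (d / (1 + d) * x ^ 2) := by
    intro x
    unfold gaussianRatio
    rw [mul_pow, ← ENNReal.ofReal_pow (by positivity), inv_pow, Real.sq_sqrt h1.le, sq (eexp _),
      ← eexp_add]
    congr 2
    field_simp
    ring
  simp_rw [h]
  rw [lintegral_const_mul _ (by fun_prop), lintegral_eexp_sq_gaussianReal
    (by rw [div_lt_iff₀ h1]; linarith), ← ENNReal.ofReal_mul (by positivity)]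
  refine ENNReal.ofReal_le_ofReal ?_
  have h2 : (1 + d)⁻¹ * (√(1 - 2 * (d / (1 + d))))⁻¹ = (√(1 - d ^ 2))⁻¹ := by
    have e : 1 - d ^ 2 = (1 + d) ^ 2 * (1 - 2 * (d / (1 + d))) := by field_simp; ring
    rw [e, Real.sqrt_mul (by positivity), Real.sqrt_sq h1.le, mul_inv]
  rw [h2]
  exact inv_sqrt_one_sub_le_exp (sq_nonneg d) (by linarith)

lemma pi_withDensity {ι : Type*} [Fintype ι] (μ : Measure ℝ) [IsProbabilityMeasure μ]
    (f : ι → ℝ → ENNReal) (hf : ∀ i, Measurable (f i))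
    [∀ i, IsProbabilityMeasure (μ.withDensity (f i))] :
    Measure.pi (fun i => μ.withDensity (f i))
      = (Measure.pi fun _ => μ).withDensity fun x => ∏ i, f i (x i) := by
  refine Measure.pi_eq fun s hs => ?_
  rw [withDensity_apply _ (MeasurableSet.univ_pi hs),
    ← lintegral_indicator (MeasurableSet.univ_pi hs)]
  have h : ∀ x : ι → ℝ, (Set.univ.pi s).indicator (fun x => ∏ i, f i (x i)) x
      = ∏ i, (s i).indicator (f i) (x i) := by
    intro x
    by_cases hx : x ∈ Set.univ.pi s
    · rw [Set.indicator_of_mem hx]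
      exact Finset.prod_congr rfl fun i _ =>
        (Set.indicator_of_mem (hx i (Set.mem_univ i)) _).symm
    · rw [Set.indicator_of_notMem hx]
      simp only [Set.mem_pi, Set.mem_univ, true_implies, not_forall] at hx
      obtain ⟨i, hi⟩ := hx
      exact (Finset.prod_eq_zero (Finset.mem_univ i) (Set.indicator_of_notMem hi _)).symm
  simp_rw [h]
  rw [lintegral_pi_prod (fun _ => μ) (fun i => (s i).indicator (f i))
    fun i => (hf i).indicator (hs i)]
  refine Finset.prod_congr rfl fun i _ => ?_
  rw [lintegral_indicator (hs i), withDensity_apply _ (hs i)]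

/-- Rescaling the coordinates of a standard Gaussian vector by factors close to `1` increases the
mean of a function with values in `[0, 1]` at most to a multiple of its square root: the density
is bounded in `L²`. -/
theorem lintegral_pi_gaussian_rescale_le {ι : Type*} [Fintype ι] (d : ι → ℝ)
    (hd : ∑ i, d i ^ 2 ≤ 1 / 16) {Ψ : (ι → ℝ) → ENNReal} (hΨ : Measurable Ψ)
    (hΨ1 : ∀ x, Ψ x ≤ 1) :
    ∫⁻ x, Ψ (fun i => √(1 + d i) * x i) ∂(Measure.pi fun _ : ι => gaussianReal 0 1)
      ≤ 2 * (∫⁻ x, Ψ x ∂(Measure.pi fun _ : ι => gaussianReal 0 1)) ^ (1 / 2 : ℝ) := by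
  have hdi : ∀ i, d i ^ 2 ≤ 1 / 16 := fun i =>
    (Finset.single_le_sum (f := fun i => d i ^ 2) (fun _ _ => sq_nonneg _)
      (Finset.mem_univ i)).trans hd
  have hd1 : ∀ i, -1 < d i := fun i => by nlinarith [hdi i]
  have hmap : (Measure.pi fun _ : ι => gaussianReal 0 1).map (fun x i => √(1 + d i) * x i)
      = (Measure.pi fun _ => gaussianReal 0 1).withDensity
          fun x => ∏ i, gaussianRatio (d i) (x i) := by
    have hp : ∀ i, IsProbabilityMeasure ((gaussianReal 0 1).withDensity (gaussianRatio (d i))) :=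
      fun i => by
        rw [← gaussianReal_map_sqrt_mul (hd1 i)]
        exact Measure.isProbabilityMeasure_map (by fun_prop)
    rw [← pi_withDensity (gaussianReal 0 1) (fun i => gaussianRatio (d i))
      (fun i => measurable_gaussianRatio (d i))]
    simp_rw [← gaussianReal_map_sqrt_mul (hd1 _)]
    have hp2 : ∀ i, IsProbabilityMeasure ((gaussianReal 0 1).map fun x => √(1 + d i) * x) :=
      fun i => Measure.isProbabilityMeasure_map (by fun_prop)
    exact Measure.pi_map_pi (fun i => by fun_prop)
  have hmF : Measurable fun x : ι → ℝ => ∏ i, gaussianRatio (d i) (x i) :=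
    Finset.measurable_prod _ fun i _ => (measurable_gaussianRatio (d i)).comp
      (measurable_pi_apply i)
  rw [← lintegral_map (f := Ψ) (g := fun x : ι → ℝ => fun i => √(1 + d i) * x i) hΨ
    (by fun_prop), hmap, lintegral_withDensity_eq_lintegral_mul _ hmF hΨ]
  -- Cauchy–Schwarz; `Ψ ^ 2 ≤ Ψ` because `Ψ ≤ 1`.
  refine (ENNReal.lintegral_mul_le_Lp_mul_Lq _ Real.HolderConjugate.two_two hmF.aemeasurable
    hΨ.aemeasurable).trans ?_
  gcongr with x
  · have h2 : ∀ x : ι → ℝ, (∏ i, gaussianRatio (d i) (x i)) ^ (2 : ℝ)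
        = ∏ i, gaussianRatio (d i) (x i) ^ 2 := by
      intro x
      rw [Finset.prod_pow, ← ENNReal.rpow_natCast]
      norm_num
    simp_rw [h2]
    rw [lintegral_pi_prod (fun _ => gaussianReal 0 1) (fun i y => gaussianRatio (d i) y ^ 2)
      (fun i => (measurable_gaussianRatio (d i)).pow_const 2)]
    have h3 : ∏ i, ∫⁻ y, gaussianRatio (d i) y ^ 2 ∂(gaussianReal 0 1) ≤ eexp 1 := by
      refine (Finset.prod_le_prod' fun i _ => lintegral_gaussianRatio_sq_le (hdi i)).trans ?_
      rw [← eexp_sum]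
      exact eexp_le_eexp (by linarith)
    have h4 : eexp 1 ≤ 4 := by
      unfold eexp
      rw [show (4 : ENNReal) = ENNReal.ofReal 4 by norm_num]
      exact ENNReal.ofReal_le_ofReal (by linarith [Real.exp_one_lt_d9])
    calc _ ≤ (4 : ENNReal) ^ (1 / 2 : ℝ) := by gcongr; exact h3.trans h4
      _ = 2 := by
        rw [show (4 : ENNReal) = 2 ^ (2 : ℝ) by norm_num, ← ENNReal.rpow_mul]
        norm_num
  · calc Ψ x ^ (2 : ℝ) ≤ Ψ x ^ (1 : ℝ) := ENNReal.rpow_le_rpow_of_exponent_ge (hΨ1 x) (by norm_num)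
      _ = Ψ x := ENNReal.rpow_one _

lemma sum_sq_eigenvalues {ι : Type*} [Fintype ι] [DecidableEq ι] {A : Matrix ι ι ℝ}
    (hA : A.IsHermitian) : ∑ k, hA.eigenvalues k ^ 2 = ∑ i, ∑ j, A i j ^ 2 := by
  have h1 : ∀ k, hA.eigenvalues k ^ 2
      = ∑ i, inner ℝ (hA.eigenvectorBasis k) (WithLp.toLp 2 (A i)) ^ 2 := by
    intro k
    have h := hA.mulVec_eigenvectorBasis k
    have h2 : ∀ i, inner ℝ (hA.eigenvectorBasis k) (WithLp.toLp 2 (A i))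
        = hA.eigenvalues k * hA.eigenvectorBasis k i := by
      intro i
      have := congrFun h i
      simp only [Matrix.mulVec, dotProduct, Pi.smul_apply, smul_eq_mul] at this
      rw [← this]
      simp [PiLp.inner_apply]
    simp_rw [h2, mul_pow]
    rw [← Finset.mul_sum, ← EuclideanSpace.real_norm_sq_eq,
      hA.eigenvectorBasis.norm_eq_one]
    simp
  simp_rw [h1]
  rw [Finset.sum_comm]
  refine Finset.sum_congr rfl fun i _ => ?_
  have := hA.eigenvectorBasis.sum_sq_norm_inner_right (WithLp.toLp 2 (A i))
  simp only [Real.norm_eq_abs, sq_abs] at this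
  rw [this, EuclideanSpace.real_norm_sq_eq]

/-- If `a` is the dual family of `p`, then the orthogonal projection away from the span of `p`
splits squared norms. -/
lemma norm_sq_eq_add_residual {E : Type*} [NormedAddCommGroup E]
    [InnerProductSpace ℝ E] {ι : Type*} [Fintype ι] [DecidableEq ι] {p a : ι → E}
    {G H : Matrix ι ι ℝ} (hG : ∀ i j, G i j = inner ℝ (p i) (p j)) (hHG : H * G = 1)
    (ha : ∀ i, a i = ∑ j, H i j • p j) (t : E) :
    ‖t‖ ^ 2 = ‖∑ i, inner ℝ (a i) t • p i‖ ^ 2 + ‖t - ∑ i, inner ℝ (a i) t • p i‖ ^ 2 := by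
  have hGH : G * H = 1 := mul_eq_one_comm.1 hHG
  have hp : ∀ i, p i = ∑ j, G i j • a j := by
    intro i
    simp_rw [ha, Finset.smul_sum, smul_smul]
    rw [Finset.sum_comm]
    simp_rw [← Finset.sum_smul, ← Matrix.mul_apply, hGH]
    simp [Matrix.one_apply]
  have h1 : ∀ i, inner ℝ (p i) (t - ∑ j, inner ℝ (a j) t • p j) = 0 := by
    intro i
    rw [inner_sub_right, inner_sum, sub_eq_zero]
    conv_lhs => rw [hp i, sum_inner]
    refine Finset.sum_congr rfl fun j _ => ?_
    rw [real_inner_smul_left, real_inner_smul_right, hG, mul_comm]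
  have h2 : inner ℝ (∑ i, inner ℝ (a i) t • p i) (t - ∑ i, inner ℝ (a i) t • p i) = 0 := by
    rw [sum_inner]
    exact Finset.sum_eq_zero fun i _ => by rw [real_inner_smul_left, h1, mul_zero]
  have h3 := norm_add_sq_eq_norm_sq_add_norm_sq_real h2
  rw [add_sub_cancel] at h3
  nlinarith [h3]

/-- The component of `z` that is invisible to the functionals `⟪p i, ·⟫`, when `a` is the dual
family of `p`. -/
noncomputable def dualResidual {E : Type*} [NormedAddCommGroup E]
    [InnerProductSpace ℝ E] {ι : Type*} [Fintype ι] (p a : ι → E) : E →L[ℝ] E :=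
  ContinuousLinearMap.id ℝ E - ∑ i, (innerSL ℝ (p i)).smulRight (a i)

lemma dualResidual_apply {E : Type*} [NormedAddCommGroup E]
    [InnerProductSpace ℝ E] {ι : Type*} [Fintype ι] (p a : ι → E) (z : E) :
    dualResidual p a z = z - ∑ i, inner ℝ (p i) z • a i := by
  simp [dualResidual]

lemma adjoint_dualResidual_apply {E : Type*} [NormedAddCommGroup E]
    [InnerProductSpace ℝ E] [FiniteDimensional ℝ E] {ι : Type*} [Fintype ι] (p a : ι → E) (t : E) :
    (dualResidual p a).adjoint t = t - ∑ i, inner ℝ (a i) t • p i := by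
  refine ext_inner_right ℝ fun z => ?_
  rw [ContinuousLinearMap.adjoint_inner_left, dualResidual_apply, inner_sub_left, inner_sub_right,
    inner_sum, sum_inner]
  congr 1
  refine Finset.sum_congr rfl fun i _ => ?_
  rw [real_inner_smul_left, real_inner_smul_right, real_inner_comm t]
  ring

section ChangeOfMeasure

variable {E : Type*} [NormedAddCommGroup E] [InnerProductSpace ℝ E] [FiniteDimensional ℝ E]
  [MeasurableSpace E] [BorelSpace E]

lemma charFun_map_stdGaussian {F : Type*} [NormedAddCommGroup F] [InnerProductSpace ℝ F]
    [FiniteDimensional ℝ F] [MeasurableSpace F] [BorelSpace F] (L : F →L[ℝ] E) (t : E) :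
    charFun ((stdGaussian F).map L) t = Complex.exp (-‖L.adjoint t‖ ^ 2 / 2) := by
  rw [← charFun_stdGaussian, charFun_apply, charFun_apply,
    integral_map (by fun_prop) (by fun_prop)]
  simp_rw [ContinuousLinearMap.adjoint_inner_right]

/-- If the Gram matrix `G` of `p` is close to the identity in Frobenius norm, then a standard
Gaussian vector may be replaced by one for which the variables `⟪p i, ·⟫` are independent standard
normal, namely by `∑ i, h i • a i` plus an independent Gaussian vector orthogonal to all `p i`. -/
theorem lintegral_stdGaussian_le_of_gram {ι : Type*} [Fintype ι] [DecidableEq ι] {p a : ι → E}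
    {G H : Matrix ι ι ℝ} (hG : ∀ i j, G i j = inner ℝ (p i) (p j)) (hHG : H * G = 1)
    (ha : ∀ i, a i = ∑ j, H i j • p j)
    (hF : ∑ i, ∑ j, (G - 1) i j ^ 2 ≤ 1 / 16) {Φ : E → ENNReal} (hΦ : Measurable Φ)
    (hΦ1 : ∀ z, Φ z ≤ 1) :
    ∫⁻ z, Φ z ∂(stdGaussian E) ≤
      2 * (∫⁻ h, ∫⁻ z, Φ (∑ i, h i • a i + dualResidual p a z) ∂(stdGaussian E)
        ∂(Measure.pi fun _ : ι => gaussianReal 0 1)) ^ (1 / 2 : ℝ) := by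
  have hE : (G - 1).IsHermitian := by
    refine Matrix.IsHermitian.ext fun i j => ?_
    simp [hG, Matrix.one_apply, real_inner_comm, eq_comm]
  set o := hE.eigenvectorBasis with ho
  set d := hE.eigenvalues with hd
  have hdF : ∑ k, d k ^ 2 ≤ 1 / 16 := by rw [hd, sum_sq_eigenvalues]; exact hF
  have hd1 : ∀ k, 0 ≤ 1 + d k := by
    intro k
    have := (Finset.single_le_sum (f := fun k => d k ^ 2) (fun _ _ => sq_nonneg _)
      (Finset.mem_univ k)).trans hdF
    nlinarith
  let e := EuclideanSpace.basisFun ι ℝ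
  -- In an eigenbasis of `G - 1` the Gaussian coefficients of the `a i` become independent with
  -- variances `1 + d k`; `L` rebuilds the component in the span of the `a i` from white noise.
  let L : EuclideanSpace ℝ ι →L[ℝ] E :=
    ∑ k, (EuclideanSpace.proj k).smulRight (√(1 + d k) • ∑ i, o k i • a i)
  have hL : ∀ c, L c = ∑ i, (∑ k, (√(1 + d k) * c k) • o k) i • a i := by
    intro c
    simp only [L, _root_.sum_apply, ContinuousLinearMap.smulRight_apply,
      PiLp.proj_apply, Finset.smul_sum, smul_smul, WithLp.ofLp_sum,
      Finset.sum_apply, PiLp.smul_apply, smul_eq_mul, Finset.sum_smul]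
    rw [Finset.sum_comm]
    refine Finset.sum_congr rfl fun i _ => Finset.sum_congr rfl fun k _ => ?_
    congr 1
    ring
  have hnorm : ∀ t, ‖L.adjoint t‖ ^ 2 = ‖∑ i, inner ℝ (a i) t • p i‖ ^ 2 := by
    intro t
    set y : EuclideanSpace ℝ ι := WithLp.toLp 2 fun i => inner ℝ (a i) t with hy
    have h1 : ∀ k, inner ℝ (e k) (L.adjoint t) = √(1 + d k) * inner ℝ (o k) y := by
      intro k
      have h2 : L (e k) = √(1 + d k) • ∑ i, o k i • a i := by
        simp [L, e, PiLp.single_apply]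
      rw [ContinuousLinearMap.adjoint_inner_right, h2, real_inner_smul_left, sum_inner,
        PiLp.inner_apply]
      congr 1
      refine Finset.sum_congr rfl fun i _ => ?_
      rw [real_inner_smul_left, hy]
      simp [mul_comm]
    have h3 := e.sum_sq_norm_inner_right (L.adjoint t)
    simp only [Real.norm_eq_abs, sq_abs, h1] at h3
    have h4 := o.sum_sq_norm_inner_right y
    simp only [Real.norm_eq_abs, sq_abs] at h4
    have h5 : ∑ k, d k * inner ℝ (o k) y ^ 2 = ∑ i, ∑ j, y i * (G - 1) i j * y j := by
      have h6 : ∀ k, d k * inner ℝ (o k) y = inner ℝ (o k) (WithLp.toLp 2 ((G - 1) *ᵥ y)) := by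
        intro k
        have h7 := hE.mulVec_eigenvectorBasis k
        have h8 : inner ℝ (o k) (WithLp.toLp 2 ((G - 1) *ᵥ y))
            = ((G - 1) *ᵥ (o k).ofLp) ⬝ᵥ y.ofLp := by
          have hT : (G - 1)ᵀ = G - 1 := by
            have := hE
            rwa [Matrix.IsHermitian, Matrix.conjTranspose_eq_transpose_of_trivial] at this
          rw [EuclideanSpace.inner_eq_star_dotProduct]
          simp only [star_trivial]
          rw [dotProduct_comm, Matrix.dotProduct_mulVec, ← Matrix.mulVec_transpose, hT]
        rw [h8, h7, smul_dotProduct, EuclideanSpace.inner_eq_star_dotProduct, smul_eq_mul,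
          dotProduct_comm]
        simp [ho, hd]
      have h9 := o.sum_inner_mul_inner y (WithLp.toLp 2 ((G - 1) *ᵥ y))
      rw [EuclideanSpace.inner_eq_star_dotProduct] at h9
      simp only [star_trivial, Matrix.mulVec, dotProduct] at h9
      calc ∑ k, d k * inner ℝ (o k) y ^ 2
          = ∑ k, inner ℝ y (o k) * inner ℝ (o k) (WithLp.toLp 2 ((G - 1) *ᵥ y)) := by
            refine Finset.sum_congr rfl fun k _ => ?_
            rw [← h6, real_inner_comm]
            ring
        _ = _ := by
            refine h9.trans (Finset.sum_congr rfl fun i _ => ?_)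
            rw [Finset.sum_mul]
            exact Finset.sum_congr rfl fun j _ => by ring
    have h10 : ‖∑ i, inner ℝ (a i) t • p i‖ ^ 2 = ∑ i, ∑ j, y i * G i j * y j := by
      rw [← real_inner_self_eq_norm_sq, sum_inner]
      refine Finset.sum_congr rfl fun i _ => ?_
      rw [inner_sum]
      refine Finset.sum_congr rfl fun j _ => ?_
      rw [real_inner_smul_left, real_inner_smul_right, hG, hy]
      ring
    rw [← h3, h10]
    have h11 : ∀ k, (√(1 + d k) * inner ℝ (o k) y) ^ 2
        = inner ℝ (o k) y ^ 2 + d k * inner ℝ (o k) y ^ 2 := by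
      intro k
      rw [mul_pow, Real.sq_sqrt (hd1 k)]
      ring
    simp_rw [h11]
    rw [Finset.sum_add_distrib, h4, h5, EuclideanSpace.real_norm_sq_eq,
      ← Finset.sum_add_distrib]
    refine Finset.sum_congr rfl fun i _ => ?_
    have h12 : ∀ j, y i * (G - 1) i j * y j
        = y i * G i j * y j - if i = j then y i * y j else 0 := by
      intro j
      rw [Matrix.sub_apply, Matrix.one_apply]
      split_ifs <;> ring
    simp_rw [h12]
    rw [Finset.sum_sub_distrib, Finset.sum_ite_eq]
    simp
    ring
  -- Both sides are centred Gaussian with the same covariance.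
  have hlaw : stdGaussian E
      = ((stdGaussian (EuclideanSpace ℝ ι)).map L) ∗ ((stdGaussian E).map (dualResidual p a)) := by
    have i1 : IsProbabilityMeasure ((stdGaussian (EuclideanSpace ℝ ι)).map L) :=
      Measure.isProbabilityMeasure_map (by fun_prop)
    have i2 : IsProbabilityMeasure ((stdGaussian E).map (dualResidual p a)) :=
      Measure.isProbabilityMeasure_map (by fun_prop)
    apply Measure.ext_of_charFun
    ext t
    rw [charFun_conv, charFun_map_stdGaussian, charFun_map_stdGaussian, charFun_stdGaussian,
      ← Complex.exp_add]
    congr 1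
    have h1 := norm_sq_eq_add_residual hG hHG ha t
    rw [← hnorm, ← adjoint_dualResidual_apply] at h1
    have h2 : ((‖t‖ : ℂ)) ^ 2
        = (‖L.adjoint t‖ : ℂ) ^ 2 + (‖(dualResidual p a).adjoint t‖ : ℂ) ^ 2 := by
      exact_mod_cast h1
    rw [h2]
    ring
  set Ψ : (ι → ℝ) → ENNReal := fun x =>
    ∫⁻ z, Φ (∑ i, (∑ k, x k • o k) i • a i + dualResidual p a z) ∂(stdGaussian E) with hΨ
  have hΨm : Measurable Ψ := by
    rw [hΨ]
    refine Measurable.lintegral_prod_right' (f := fun q : (ι → ℝ) × E =>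
      Φ (∑ i, (∑ k, q.1 k • o k) i • a i + dualResidual p a q.2)) ?_
    refine hΦ.comp ?_
    simp only [WithLp.ofLp_sum, Finset.sum_apply, PiLp.smul_apply]
    fun_prop
  have hm2 : Measurable fun c : EuclideanSpace ℝ ι =>
      ∫⁻ z, Φ (∑ i, c i • a i + dualResidual p a z) ∂(stdGaussian E) := by
    refine Measurable.lintegral_prod_right' (f := fun q : EuclideanSpace ℝ ι × E =>
      Φ (∑ i, q.1 i • a i + dualResidual p a q.2)) ?_
    exact hΦ.comp (by fun_prop)
  have hleft : ∫⁻ z, Φ z ∂(stdGaussian E)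
      = ∫⁻ x, Ψ (fun k => √(1 + d k) * x k) ∂(Measure.pi fun _ : ι => gaussianReal 0 1) := by
    conv_lhs => rw [hlaw]
    rw [Measure.lintegral_conv hΦ, lintegral_map (by fun_prop) (by fun_prop),
      ← map_pi_eq_stdGaussian, lintegral_map (by fun_prop) (by fun_prop)]
    refine lintegral_congr fun x => ?_
    rw [lintegral_map (by fun_prop) (by fun_prop), hL]
  have hright : ∫⁻ x, Ψ x ∂(Measure.pi fun _ : ι => gaussianReal 0 1)
      = ∫⁻ h, ∫⁻ z, Φ (∑ i, h i • a i + dualResidual p a z) ∂(stdGaussian E)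
        ∂(Measure.pi fun _ : ι => gaussianReal 0 1) := by
    rw [hΨ, ← lintegral_stdGaussian o hm2, ← map_pi_eq_stdGaussian,
      lintegral_map hm2 (by fun_prop)]
  rw [hleft, ← hright]
  refine lintegral_pi_gaussian_rescale_le d hdF hΨm fun x => ?_
  calc Ψ x ≤ ∫⁻ _, 1 ∂(stdGaussian E) := lintegral_mono fun z => hΦ1 _
    _ = 1 := by simp

end ChangeOfMeasure

/-! ### Tail bounds for independent observations -/

lemma exp_le_add_exp_sq (x : ℝ) : Real.exp x ≤ x + Real.exp (x ^ 2) := by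
  have h2 := Real.add_one_le_exp (x ^ 2)
  rcases le_or_gt |x| 1 with h | h
  · have h1 := (abs_le.1 (Real.abs_exp_sub_one_sub_id_le h)).2
    linarith
  · rcases lt_abs.1 h with h | h
    · have := Real.exp_le_exp.2 (show x ≤ x ^ 2 by nlinarith)
      linarith
    · have := Real.exp_le_one_iff.2 (show x ≤ 0 by linarith)
      nlinarith

lemma integrable_sign_mul {S : Type*} [MeasurableSpace S] (μ : Measure S)
    {b h : S → ℝ} (hb : Measurable b) (hb1 : ∀ x, b x = 1 ∨ b x = -1)
    (hh : MeasurePreserving h μ (gaussianReal 0 1)) : Integrable (fun x => b x * h x) μ := by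
  have hi : Integrable h μ := by
    have := (memLp_id_gaussianReal (μ := 0) (v := 1) 1).integrable (by simp)
    exact hh.integrable_comp_of_integrable this
  refine hi.bdd_mul (c := 1) hb.aestronglyMeasurable (.of_forall fun x => ?_)
  rcases hb1 x with h | h <;> simp [h]

section SignedGaussian

variable {S : Type*} [MeasurableSpace S] (μ : Measure S) [IsProbabilityMeasure μ] {b h : S → ℝ}

lemma integral_sign_mul_sq_le_one (hb : Measurable b) (hb1 : ∀ x, b x = 1 ∨ b x = -1)
    (hh : MeasurePreserving h μ (gaussianReal 0 1)) : (∫ x, b x * h x ∂μ) ^ 2 ≤ 1 := by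
  have hi2 : Integrable (fun y : ℝ => y ^ 2) (gaussianReal 0 1) :=
    (memLp_id_gaussianReal (μ := 0) (v := 1) 2).integrable_sq
  have h2 : ∫ y, y ^ 2 ∂(gaussianReal 0 1) = 1 := by
    have := variance_fun_id_gaussianReal (μ := 0) (v := 1)
    rw [variance_of_integral_eq_zero (by fun_prop) (by simp)] at this
    simpa using this
  have hi3 : Integrable (fun x => h x ^ 2) μ := hh.integrable_comp_of_integrable hi2
  have h3 : ∫ x, h x ^ 2 ∂μ = 1 := by
    rw [← h2, ← hh.map_eq, integral_map hh.measurable.aemeasurable (by fun_prop)]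
  have h4 : |∫ x, b x * h x ∂μ| ≤ ∫ x, (1 + h x ^ 2) / 2 ∂μ := by
    refine abs_integral_le_integral_abs.trans (integral_mono
      (integrable_sign_mul μ hb hb1 hh).abs (((integrable_const 1).add hi3).div_const 2) ?_)
    intro x
    have : |b x * h x| = |h x| := by rcases hb1 x with h | h <;> simp [h]
    simp only [this]
    nlinarith [sq_nonneg (|h x| - 1), sq_abs (h x)]
  rw [integral_div, integral_add (integrable_const _) hi3, h3] at h4
  rw [sq_le_one_iff_abs_le_one]
  simpa using h4

/-- The product of a standard normal variable with a sign, once centred, is subgaussian. -/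
lemma lintegral_eexp_sign_mul_sub_le (hb : Measurable b) (hb1 : ∀ x, b x = 1 ∨ b x = -1)
    (hh : MeasurePreserving h μ (gaussianReal 0 1)) {s : ℝ} (hs : s ^ 2 ≤ 1 / 8) :
    ∫⁻ x, eexp (s * (b x * h x - ∫ x, b x * h x ∂μ)) ∂μ ≤ eexp (6 * s ^ 2) := by
  set lam := ∫ x, b x * h x ∂μ with hlam
  have hl : lam ^ 2 ≤ 1 := integral_sign_mul_sq_le_one μ hb hb1 hh
  have hhm := hh.measurable
  have hbh := integrable_sign_mul μ hb hb1 hh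
  have hE : ∫⁻ x, eexp (2 * s ^ 2 * h x ^ 2 + 2 * s ^ 2) ∂μ ≤ eexp (6 * s ^ 2) := by
    simp_rw [eexp_add]
    rw [lintegral_mul_const _ (by fun_prop),
      hh.lintegral_comp (f := fun y => eexp (2 * s ^ 2 * y ^ 2)) (by fun_prop)]
    refine (mul_le_mul_left (lintegral_eexp_sq_gaussianReal_le (by positivity)
      (by linarith)) _).trans ?_
    rw [← eexp_add]
    exact eexp_le_eexp (by linarith)
  have hEi : Integrable (fun x => Real.exp (2 * s ^ 2 * h x ^ 2 + 2 * s ^ 2)) μ := by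
    refine ⟨by fun_prop, ?_⟩
    rw [hasFiniteIntegral_iff_ofReal (.of_forall fun _ => Real.exp_nonneg _)]
    exact hE.trans_lt (eexp_ne_top _).lt_top
  have hpt : ∀ x, Real.exp (s * (b x * h x - lam))
      ≤ s * (b x * h x - lam) + Real.exp (2 * s ^ 2 * h x ^ 2 + 2 * s ^ 2) := by
    intro x
    refine (exp_le_add_exp_sq _).trans ?_
    gcongr
    have h1 : (b x * h x) ^ 2 = h x ^ 2 := by rcases hb1 x with h | h <;> simp [h]
    have h2 : (b x * h x - lam) ^ 2 ≤ 2 * h x ^ 2 + 2 := by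
      nlinarith [sq_nonneg (b x * h x + lam)]
    nlinarith [mul_le_mul_of_nonneg_left h2 (sq_nonneg s)]
  have hi1 : Integrable (fun x => s * (b x * h x - lam)) μ :=
    (hbh.sub (integrable_const _)).const_mul _
  have h0 : ∫ x, s * (b x * h x - lam) ∂μ = 0 := by
    rw [integral_const_mul, integral_sub hbh (integrable_const _), ← hlam]
    simp
  calc ∫⁻ x, eexp (s * (b x * h x - lam)) ∂μ
      ≤ ∫⁻ x, ENNReal.ofReal (s * (b x * h x - lam) +
          Real.exp (2 * s ^ 2 * h x ^ 2 + 2 * s ^ 2)) ∂μ :=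
        lintegral_mono fun x => ENNReal.ofReal_le_ofReal (hpt x)
    _ = ENNReal.ofReal (∫ x, (s * (b x * h x - lam) +
          Real.exp (2 * s ^ 2 * h x ^ 2 + 2 * s ^ 2)) ∂μ) :=
        (ofReal_integral_eq_lintegral_ofReal (hi1.add hEi)
          (.of_forall fun x => (Real.exp_nonneg _).trans (hpt x))).symm
    _ = ∫⁻ x, eexp (2 * s ^ 2 * h x ^ 2 + 2 * s ^ 2) ∂μ := by
        rw [integral_add hi1 hEi, h0, zero_add,
          ofReal_integral_eq_lintegral_ofReal hEi (.of_forall fun _ => Real.exp_nonneg _)]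
        rfl
    _ ≤ _ := hE

variable {ι : Type*} [Fintype ι]

lemma lintegral_eexp_sum_sign_mul_sub_le (hb : Measurable b) (hb1 : ∀ x, b x = 1 ∨ b x = -1)
    (hh : MeasurePreserving h μ (gaussianReal 0 1)) (c : ι → ℝ) (hc : ∀ i, c i ^ 2 ≤ 1 / 8) :
    ∫⁻ x, eexp (∑ i, c i * (b (x i) * h (x i) - ∫ x, b x * h x ∂μ)) ∂(Measure.pi fun _ : ι => μ)
      ≤ eexp (6 * ∑ i, c i ^ 2) := by
  have hhm := hh.measurable
  simp_rw [eexp_sum]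
  rw [lintegral_pi_prod (fun _ => μ)
    (fun i y => eexp (c i * (b y * h y - ∫ x, b x * h x ∂μ))) (fun i => by fun_prop),
    Finset.mul_sum, eexp_sum]
  exact Finset.prod_le_prod' fun i _ => lintegral_eexp_sign_mul_sub_le μ hb hb1 hh (hc i)

/-- After decoupling, Cauchy–Schwarz with the Frobenius norm reduces the off-diagonal chaos to the
exponential moment of `∑ h (x j) ^ 2`. -/
lemma lintegral_eexp_offDiag_le [DecidableEq ι] (hb : Measurable b)
    (hb1 : ∀ x, b x = 1 ∨ b x = -1) (hb0 : ∫ x, b x ∂μ = 0)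
    (hh : MeasurePreserving h μ (gaussianReal 0 1)) (c : ι → ι → ℝ) (hc : ∀ i, c i i = 0)
    {F : ℝ} (hF : ∑ i, ∑ j, c i j ^ 2 ≤ F) (hF1 : F ≤ 1 / 32) :
    ∫⁻ x, eexp (∑ i, ∑ j, c i j * b (x i) * h (x j)) ∂(Measure.pi fun _ : ι => μ)
      ≤ eexp (16 * F * Fintype.card ι) := by
  have hF0 : 0 ≤ F := le_trans (by positivity) hF
  have hhm := hh.measurable
  refine lintegral_eexp_quadratic_le μ hb hhm (lintegral_eexp_sign_le μ hb hb1 hb0) c hc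
    fun ε => ?_
  have hpt : ∀ x : ι → S, 8 * ∑ i, (∑ j, if ε i ∧ ¬ ε j then c i j * h (x j) else 0) ^ 2
      ≤ ∑ j, 8 * F * h (x j) ^ 2 := by
    intro x
    rw [← Finset.mul_sum, mul_assoc]
    gcongr
    calc ∑ i, (∑ j, if ε i ∧ ¬ ε j then c i j * h (x j) else 0) ^ 2
        ≤ ∑ i, (∑ j, c i j ^ 2) * ∑ j, h (x j) ^ 2 := by
          refine Finset.sum_le_sum fun i _ => ?_
          have h1 : ∀ j, (if ε i ∧ ¬ ε j then c i j * h (x j) else 0)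
              = c i j * (if ε i ∧ ¬ ε j then h (x j) else 0) := by
            intro j; split_ifs <;> simp
          simp_rw [h1]
          refine (Finset.sum_mul_sq_le_sq_mul_sq _ _ _).trans ?_
          refine mul_le_mul_of_nonneg_left (Finset.sum_le_sum fun j _ => ?_) (by positivity)
          split_ifs
          · exact le_rfl
          · simp [sq_nonneg]
      _ = (∑ i, ∑ j, c i j ^ 2) * ∑ j, h (x j) ^ 2 := by rw [Finset.sum_mul]
      _ ≤ _ := by gcongr
  refine (lintegral_mono fun x => eexp_le_eexp (hpt x)).trans ?_
  simp_rw [eexp_sum]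
  rw [lintegral_pi_prod (fun _ => μ) (fun _ y => eexp (8 * F * h y ^ 2)) (fun i => by fun_prop)]
  have h1 : ∫⁻ y, eexp (8 * F * h y ^ 2) ∂μ ≤ eexp (16 * F) := by
    rw [hh.lintegral_comp (f := fun y => eexp (8 * F * y ^ 2)) (by fun_prop)]
    refine (lintegral_eexp_sq_gaussianReal_le (by positivity) (by linarith)).trans
      (eexp_le_eexp (by linarith))
  refine (Finset.prod_le_prod' fun i _ => h1).trans ?_
  rw [← eexp_sum]
  refine eexp_le_eexp ?_
  simp [mul_comm]

variable {E : Type*} [NormedAddCommGroup E] [InnerProductSpace ℝ E] [FiniteDimensional ℝ E]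
  [MeasurableSpace E] [BorelSpace E]

/-- A Gaussian vector paired with a random signed sum: the Gaussian integration is undone after
dropping `R`, so that the signs are integrated first and leave a Gaussian quadratic form. -/
lemma lintegral_eexp_sign_inner_le (hb : Measurable b)
    (hb1 : ∀ x, b x = 1 ∨ b x = -1) (hb0 : ∫ x, b x ∂μ = 0) (u : ι → E) (R : E →L[ℝ] E)
    (hR : ∀ t, ‖R.adjoint t‖ ≤ ‖t‖) {s L : ℝ}
    (hL : ∀ z, ∑ i, inner ℝ z (u i) ^ 2 ≤ L * ‖z‖ ^ 2) (hsL : s ^ 2 * L ≤ 1 / 2) :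
    ∫⁻ x, ∫⁻ z, eexp (s * ∑ i, b (x i) * inner ℝ (R z) (u i)) ∂(stdGaussian E)
        ∂(Measure.pi fun _ : ι => μ) ≤ eexp (s ^ 2 * ∑ i, ‖u i‖ ^ 2) := by
  have h1 : ∀ x : ι → S, ∫⁻ z, eexp (s * ∑ i, b (x i) * inner ℝ (R z) (u i)) ∂(stdGaussian E)
      ≤ ∫⁻ z, eexp (∑ i, s * inner ℝ z (u i) * b (x i)) ∂(stdGaussian E) := by
    intro x
    set y : E := ∑ i, (s * b (x i)) • u i with hy
    have e1 : ∀ z : E, s * ∑ i, b (x i) * inner ℝ (R z) (u i) = inner ℝ z (R.adjoint y) := by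
      intro z
      rw [ContinuousLinearMap.adjoint_inner_right, hy, inner_sum, Finset.mul_sum]
      refine Finset.sum_congr rfl fun i _ => ?_
      rw [real_inner_smul_right, mul_assoc]
    have e2 : ∀ z : E, ∑ i, s * inner ℝ z (u i) * b (x i) = inner ℝ z y := by
      intro z
      rw [hy, inner_sum]
      refine Finset.sum_congr rfl fun i _ => ?_
      rw [real_inner_smul_right]
      ring
    simp_rw [e1, e2, lintegral_eexp_inner_stdGaussian]
    refine eexp_le_eexp ?_
    gcongr
    exact hR y
  refine (lintegral_mono h1).trans ?_
  rw [lintegral_lintegral_swap]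
  · refine (lintegral_mono (g := fun z => eexp (s ^ 2 / 2 * ∑ i, inner ℝ z (u i) ^ 2))
      fun z => ?_).trans ?_
    · simp only [eexp_sum]
      rw [lintegral_pi_prod (fun _ => μ) (fun i y => eexp (s * inner ℝ z (u i) * b y))
        (fun i => by fun_prop), Finset.mul_sum, eexp_sum]
      refine Finset.prod_le_prod' fun i _ =>
        (lintegral_eexp_sign_le μ hb hb1 hb0 _).trans (eexp_le_eexp (le_of_eq ?_))
      ring
    · refine (lintegral_eexp_sum_inner_sq_le u (by positivity) hL (by linarith)).trans
        (eexp_le_eexp (le_of_eq ?_))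
      ring
  · refine (measurable_eexp.comp (Finset.measurable_sum _ fun i _ => ?_)).aemeasurable
    fun_prop

/-- Tail bound for the correlation error once the variables `h (x i)` are exactly independent.
The matrix `⟪u i, a j⟫` has a diagonal close to the constant `α` and small off-diagonal part. -/
theorem reference_tail_le [DecidableEq ι] (hb : Measurable b)
    (hb1 : ∀ x, b x = 1 ∨ b x = -1) (hb0 : ∫ x, b x ∂μ = 0)
    (hh : MeasurePreserving h μ (gaussianReal 0 1)) (u a : ι → E) (R : E →L[ℝ] E)
    (hR : ∀ t, ‖R.adjoint t‖ ≤ ‖t‖) {s ℓ α y : ℝ} (hs0 : 0 ≤ s) (hs : s ^ 2 ≤ 1 / 64)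
    (hsℓ : s ^ 2 * ℓ ≤ 1 / 64)
    (hL : ∀ z, ∑ i, inner ℝ z (u i) ^ 2 ≤ 8 * ℓ * ‖z‖ ^ 2) (hu : ∀ i, ‖u i‖ ≤ 1)
    (hdiag : ∀ i, |inner ℝ (u i) (a i)| ≤ 2)
    (hoff : ∑ i, ∑ j, (if i = j then 0 else inner ℝ (u i) (a j)) ^ 2 ≤ 1)
    (htr : |∑ i, (inner ℝ (u i) (a i) - α)| ≤ 1) :
    ((Measure.pi fun _ : ι => μ).prod (stdGaussian E))
      {q | 3 * y + 1 ≤ |∑ i, b (q.1 i) * inner ℝ (∑ j, h (q.1 j) • a j + R q.2) (u i)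
        - Fintype.card ι * (α * ∫ x, b x * h x ∂μ)|}
      ≤ 6 * eexp (24 * s ^ 2 * Fintype.card ι - s * y) := by
  set lam := ∫ x, b x * h x ∂μ with hlam
  set m : ℝ := (Fintype.card ι : ℝ) with hm
  have hhm := hh.measurable
  have hlam1 : |lam| ≤ 1 := by
    rw [← sq_le_one_iff_abs_le_one]; exact integral_sign_mul_sq_le_one μ hb hb1 hh
  set c : ι → ι → ℝ := fun i j => if i = j then 0 else inner ℝ (u i) (a j) with hc
  -- The diagonal part, the off-diagonal chaos, and the contribution of the residual.
  let S₁ : (ι → S) × E → ℝ := fun q =>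
    ∑ i, inner ℝ (u i) (a i) * (b (q.1 i) * h (q.1 i) - lam)
  let S₂ : (ι → S) × E → ℝ := fun q => ∑ i, ∑ j, c i j * b (q.1 i) * h (q.1 j)
  let S₃ : (ι → S) × E → ℝ := fun q => ∑ i, b (q.1 i) * inner ℝ (R q.2) (u i)
  have hdecomp : ∀ q : (ι → S) × E,
      ∑ i, b (q.1 i) * inner ℝ (∑ j, h (q.1 j) • a j + R q.2) (u i) - m * (α * lam)
        = S₁ q + S₂ q + S₃ q + lam * ∑ i, (inner ℝ (u i) (a i) - α) := by
    intro q
    have e1 : m * (α * lam) = ∑ _i : ι, α * lam := by simp [hm]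
    simp only [S₁, S₂, S₃]
    rw [e1, Finset.mul_sum, ← Finset.sum_add_distrib, ← Finset.sum_add_distrib,
      ← Finset.sum_add_distrib, ← Finset.sum_sub_distrib]
    refine Finset.sum_congr rfl fun i _ => ?_
    have e2 : ∑ j, c i j * b (q.1 i) * h (q.1 j)
        = b (q.1 i) * inner ℝ (∑ j, h (q.1 j) • a j) (u i)
          - inner ℝ (u i) (a i) * (b (q.1 i) * h (q.1 i)) := by
      have e3 : inner ℝ (u i) (a i) * (b (q.1 i) * h (q.1 i))
          = ∑ j, if i = j then inner ℝ (u i) (a j) * (b (q.1 i) * h (q.1 j)) else 0 := by simp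
      rw [e3, sum_inner, Finset.mul_sum, ← Finset.sum_sub_distrib]
      refine Finset.sum_congr rfl fun j _ => ?_
      rw [real_inner_smul_left, real_inner_comm (u i)]
      simp only [hc]
      split_ifs <;> ring
    rw [e2, inner_add_left]
    ring
  have hfst : ∀ f : (ι → S) → ℝ, Measurable f → ∀ r : ℝ,
      ∫⁻ q, eexp (r * f q.1) ∂((Measure.pi fun _ : ι => μ).prod (stdGaussian E))
        = ∫⁻ x, eexp (r * f x) ∂(Measure.pi fun _ : ι => μ) := by
    intro f hf r
    exact measurePreserving_fst.lintegral_comp (f := fun x => eexp (r * f x)) (by fun_prop)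
  have hm1 : Measurable fun x : ι → S =>
      ∑ i, inner ℝ (u i) (a i) * (b (x i) * h (x i) - lam) := by fun_prop
  have hm2 : Measurable fun x : ι → S => ∑ i, ∑ j, c i j * b (x i) * h (x j) := by fun_prop
  have hm3 : Measurable S₃ := by
    refine Finset.measurable_sum _ fun i _ => ?_
    fun_prop
  have hm0 : 0 ≤ m := by positivity
  have b1 : ∀ r : ℝ, r ^ 2 = s ^ 2 →
      ∫⁻ q, eexp (r * S₁ q) ∂((Measure.pi fun _ : ι => μ).prod (stdGaussian E))
        ≤ eexp (24 * s ^ 2 * m) := by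
    intro r hr
    have hN : ∀ i, inner ℝ (u i) (a i) ^ 2 ≤ 4 := fun i => by
      nlinarith [hdiag i, abs_nonneg (inner ℝ (u i) (a i)), sq_abs (inner ℝ (u i) (a i))]
    refine (hfst _ hm1 r).trans_le ?_
    simp_rw [Finset.mul_sum, ← mul_assoc]
    refine (lintegral_eexp_sum_sign_mul_sub_le μ hb hb1 hh
      (fun i => r * inner ℝ (u i) (a i)) fun i => ?_).trans (eexp_le_eexp ?_)
    · rw [mul_pow, hr]
      nlinarith [hN i, sq_nonneg s]
    · have : ∑ i, (r * inner ℝ (u i) (a i)) ^ 2 ≤ ∑ _i : ι, s ^ 2 * 4 := by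
        refine Finset.sum_le_sum fun i _ => ?_
        rw [mul_pow, hr]
        exact mul_le_mul_of_nonneg_left (hN i) (sq_nonneg s)
      rw [Finset.sum_const, Finset.card_univ, nsmul_eq_mul] at this
      linarith
  have b2 : ∀ r : ℝ, r ^ 2 = s ^ 2 →
      ∫⁻ q, eexp (r * S₂ q) ∂((Measure.pi fun _ : ι => μ).prod (stdGaussian E))
        ≤ eexp (24 * s ^ 2 * m) := by
    intro r hr
    refine (hfst _ hm2 r).trans_le ?_
    simp_rw [Finset.mul_sum, ← mul_assoc]
    refine (lintegral_eexp_offDiag_le μ hb hb1 hb0 hh (fun i j => r * c i j)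
      (fun i => by simp [hc]) (F := s ^ 2) ?_ (by linarith)).trans (eexp_le_eexp ?_)
    · simp_rw [mul_pow, hr, ← Finset.mul_sum]
      exact (mul_le_mul_of_nonneg_left hoff (sq_nonneg s)).trans_eq (mul_one _)
    · nlinarith [mul_nonneg (sq_nonneg s) hm0]
  have b3 : ∀ r : ℝ, r ^ 2 = s ^ 2 →
      ∫⁻ q, eexp (r * S₃ q) ∂((Measure.pi fun _ : ι => μ).prod (stdGaussian E))
        ≤ eexp (24 * s ^ 2 * m) := by
    intro r hr
    rw [lintegral_prod _ (by fun_prop)]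
    refine (lintegral_eexp_sign_inner_le μ hb hb1 hb0 u R hR hL
      (by rw [hr]; linarith)).trans (eexp_le_eexp ?_)
    rw [hr]
    have : ∑ i, ‖u i‖ ^ 2 ≤ ∑ _i : ι, (1 : ℝ) :=
      Finset.sum_le_sum fun i _ => pow_le_one₀ (norm_nonneg _) (hu i)
    rw [Finset.sum_const, Finset.card_univ, nsmul_eq_mul, mul_one] at this
    nlinarith [mul_le_mul_of_nonneg_left this (sq_nonneg s), mul_nonneg (sq_nonneg s) hm0]
  have tail : ∀ f : (ι → S) × E → ℝ, Measurable f → (∀ r : ℝ, r ^ 2 = s ^ 2 →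
      ∫⁻ q, eexp (r * f q) ∂((Measure.pi fun _ : ι => μ).prod (stdGaussian E))
        ≤ eexp (24 * s ^ 2 * m)) →
      ((Measure.pi fun _ : ι => μ).prod (stdGaussian E)) {q | y ≤ |f q|}
        ≤ 2 * eexp (24 * s ^ 2 * m - s * y) := by
    intro f hf hB
    refine (measure_abs_le_eexp_mul_lintegral _ hf hs0 y (hB s rfl)
      (hB (-s) (by ring))).trans (le_of_eq ?_)
    rw [← eexp_add]
    congr 2
    ring
  have hsub : {q : (ι → S) × E | 3 * y + 1 ≤
      |∑ i, b (q.1 i) * inner ℝ (∑ j, h (q.1 j) • a j + R q.2) (u i) - m * (α * lam)|}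
      ⊆ {q | y ≤ |S₁ q|} ∪ ({q | y ≤ |S₂ q|} ∪ {q | y ≤ |S₃ q|}) := by
    intro q hq
    simp only [Set.mem_ofPred_eq, Set.mem_union] at hq ⊢
    rw [hdecomp] at hq
    by_contra hcon
    push Not at hcon
    obtain ⟨h1, h2, h3⟩ := hcon
    have h4 : |lam * ∑ i, (inner ℝ (u i) (a i) - α)| ≤ 1 := by
      rw [abs_mul]
      exact mul_le_one₀ hlam1 (abs_nonneg _) htr
    have h5 := abs_add_le (S₁ q + S₂ q + S₃ q) (lam * ∑ i, (inner ℝ (u i) (a i) - α))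
    have h6 := abs_add_le (S₁ q + S₂ q) (S₃ q)
    have h7 := abs_add_le (S₁ q) (S₂ q)
    linarith
  calc _ ≤ _ := measure_mono hsub
    _ ≤ 2 * eexp (24 * s ^ 2 * m - s * y) + (2 * eexp (24 * s ^ 2 * m - s * y)
        + 2 * eexp (24 * s ^ 2 * m - s * y)) := by
      refine (measure_union_le _ _).trans (add_le_add (tail S₁ (hm1.comp measurable_fst) b1) ?_)
      exact (measure_union_le _ _).trans
        (add_le_add (tail S₂ (hm2.comp measurable_fst) b2) (tail S₃ hm3 b3))
    _ = _ := by ring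

end SignedGaussian

/-! ### Correlations over a finite abelian group -/

section FiniteGroup

variable {Γ : Type*} [AddCommGroup Γ] [Fintype Γ]

lemma sum_addChar_norm_sq (f : Γ → ℝ) :
    ∑ ψ : AddChar Γ ℂ, ‖∑ j, (f j : ℂ) * ψ j‖ ^ 2 = Fintype.card Γ * ∑ j, f j ^ 2 := by
  classical
  have h1 : ∀ ψ : AddChar Γ ℂ, ((‖∑ j, (f j : ℂ) * ψ j‖ ^ 2 : ℝ) : ℂ)
      = ∑ j, ∑ k, (f j : ℂ) * f k * ψ (j - k) := by
    intro ψ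
    push_cast
    rw [← Complex.mul_conj', map_sum, Finset.sum_mul_sum]
    refine Finset.sum_congr rfl fun j _ => Finset.sum_congr rfl fun k _ => ?_
    rw [map_mul, Complex.conj_ofReal, ← AddChar.map_neg_eq_conj, sub_eq_add_neg,
      AddChar.map_add_eq_mul]
    ring
  have h2 : ((∑ ψ : AddChar Γ ℂ, ‖∑ j, (f j : ℂ) * ψ j‖ ^ 2 : ℝ) : ℂ)
      = ((Fintype.card Γ * ∑ j, f j ^ 2 : ℝ) : ℂ) := by
    rw [Complex.ofReal_sum]
    simp_rw [h1]
    rw [Finset.sum_comm]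
    push_cast
    rw [Finset.mul_sum]
    refine Finset.sum_congr rfl fun j _ => ?_
    rw [Finset.sum_comm]
    simp_rw [← Finset.mul_sum, AddChar.sum_apply_eq_ite, sub_eq_zero]
    simp
    ring
  exact_mod_cast h2

/-- A correlation with `f` is a Fourier multiplier: its operator norm is the largest modulus of
the Fourier transform of `f`. -/
lemma sum_correlation_sq_le {f : Γ → ℝ} {L : ℝ}
    (hL : ∀ ψ : AddChar Γ ℂ, ‖∑ j, (f j : ℂ) * ψ j‖ ^ 2 ≤ L) (z : Γ → ℝ) :
    ∑ i, (∑ k, z k * f (k + i)) ^ 2 ≤ L * ∑ k, z k ^ 2 := by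
  have h1 : ∀ ψ : AddChar Γ ℂ, ∑ i, ((∑ k, z k * f (k + i) : ℝ) : ℂ) * ψ i
      = (∑ k, (z k : ℂ) * ψ (-k)) * ∑ j, (f j : ℂ) * ψ j := by
    intro ψ
    push_cast
    simp_rw [Finset.sum_mul]
    rw [Finset.sum_comm]
    refine Finset.sum_congr rfl fun k _ => ?_
    rw [← Equiv.sum_comp (Equiv.addLeft k) fun j => (f j : ℂ) * ψ j, Finset.mul_sum]
    refine Finset.sum_congr rfl fun i _ => ?_
    have : ψ i = ψ (-k) * ψ (k + i) := by
      rw [← AddChar.map_add_eq_mul, neg_add_cancel_left]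
    rw [this, Equiv.coe_addLeft]
    ring
  have h2 : ∀ ψ : AddChar Γ ℂ, ‖∑ k, (z k : ℂ) * ψ (-k)‖ = ‖∑ k, (z k : ℂ) * ψ k‖ := by
    intro ψ
    rw [← Complex.norm_conj (∑ k, (z k : ℂ) * ψ k), map_sum]
    simp_rw [map_mul, Complex.conj_ofReal, AddChar.map_neg_eq_conj]
  have hc : (0 : ℝ) < Fintype.card Γ := by exact_mod_cast Fintype.card_pos
  have h3 := sum_addChar_norm_sq fun i => ∑ k, z k * f (k + i)
  have h4 : ∑ ψ : AddChar Γ ℂ, ‖∑ i, ((∑ k, z k * f (k + i) : ℝ) : ℂ) * ψ i‖ ^ 2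
      ≤ L * (Fintype.card Γ * ∑ k, z k ^ 2) := by
    rw [← sum_addChar_norm_sq z, Finset.mul_sum]
    refine Finset.sum_le_sum fun ψ _ => ?_
    rw [h1, norm_mul, mul_pow, h2, mul_comm]
    exact mul_le_mul_of_nonneg_right (hL ψ) (sq_nonneg _)
  rw [h3] at h4
  refine le_of_mul_le_mul_left ?_ hc
  linarith

end FiniteGroup

/-! ### Rademacher sums -/

instance isProbabilityMeasure_rademacherLaw : IsProbabilityMeasure rademacherLaw := by
  refine ⟨?_⟩
  simp only [rademacherLaw, Measure.coe_add, Measure.coe_smul, Pi.add_apply, Pi.smul_apply,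
    measure_univ, smul_eq_mul, mul_one]
  rw [← ENNReal.ofReal_add (by norm_num) (by norm_num)]
  norm_num

lemma lintegral_eexp_rademacher_le (a : ℝ) :
    ∫⁻ x, eexp (a * x) ∂rademacherLaw ≤ eexp (a ^ 2 / 2) := by
  rw [rademacherLaw, lintegral_add_measure, lintegral_smul_measure, lintegral_smul_measure,
    lintegral_dirac, lintegral_dirac]
  simp only [eexp, smul_eq_mul]
  rw [← ENNReal.ofReal_mul (by norm_num), ← ENNReal.ofReal_mul (by norm_num),
    ← ENNReal.ofReal_add (by positivity) (by positivity)]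
  refine ENNReal.ofReal_le_ofReal (le_trans (le_of_eq ?_) (Real.cosh_le_exp_half_sq a))
  rw [Real.cosh_eq]
  ring_nf

lemma ae_rademacherLaw : ∀ᵐ x ∂rademacherLaw, x = 1 ∨ x = -1 := by
  rw [rademacherLaw, ae_add_measure_iff]
  constructor <;>
  · refine Measure.ae_smul_measure ?_ _
    rw [ae_dirac_iff (by measurability)]
    simp

section Rademacher

variable {Γ : Type*} [Fintype Γ]

lemma ae_pi_rademacherLaw :
    ∀ᵐ ξ ∂(Measure.pi fun _ : Γ => rademacherLaw), ∀ j, ξ j = 1 ∨ ξ j = -1 := by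
  rw [ae_all_iff]
  intro j
  exact (measurePreserving_eval (fun _ : Γ => rademacherLaw) j).quasiMeasurePreserving.ae
    ae_rademacherLaw

lemma rademacher_sum_tail_le {c : Γ → ℝ} (hc : ∑ j, c j ^ 2 ≤ 1) {ℓ : ℝ} (hℓ : 0 ≤ ℓ) :
    (Measure.pi fun _ : Γ => rademacherLaw) {ξ | 2 * √ℓ ≤ |∑ j, c j * ξ j|}
      ≤ 2 * eexp (-(2 * ℓ)) := by
  have hB : ∀ r : ℝ, r ^ 2 = 4 * ℓ →
      ∫⁻ ξ, eexp (r * ∑ j, c j * ξ j) ∂(Measure.pi fun _ : Γ => rademacherLaw)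
        ≤ eexp (2 * ℓ) := by
    intro r hr
    simp_rw [Finset.mul_sum, ← mul_assoc, eexp_sum]
    rw [lintegral_pi_prod (fun _ => rademacherLaw) (fun j y => eexp (r * c j * y))
      (fun j => by fun_prop)]
    refine (Finset.prod_le_prod' fun j _ => lintegral_eexp_rademacher_le _).trans ?_
    rw [← eexp_sum]
    refine eexp_le_eexp ?_
    simp_rw [mul_pow, hr]
    rw [← Finset.sum_div, ← Finset.mul_sum]
    nlinarith
  have hsq := Real.sq_sqrt hℓ
  refine (measure_abs_le_eexp_mul_lintegral _ (by fun_prop) (s := 2 * √ℓ) (by positivity) _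
    (hB _ (by rw [mul_pow, hsq]; ring)) (hB _ (by rw [neg_sq, mul_pow, hsq]; ring))).trans
    (le_of_eq ?_)
  rw [← eexp_add]
  congr 2
  nlinarith

variable [AddCommGroup Γ]

/-- The Fourier coefficients of a randomly signed vector are at most of order `√log |Γ|`. -/
lemma rademacher_fourier_tail_le {v : Γ → ℝ} (hv : ∑ j, v j ^ 2 ≤ 1) {τ : ℝ} (hτ : 0 ≤ τ) :
    (Measure.pi fun _ : Γ => rademacherLaw)
      {ξ | ¬ ∀ ψ : AddChar Γ ℂ, ‖∑ j, ((ξ j * v j : ℝ) : ℂ) * ψ j‖ ^ 2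
        ≤ 8 * (τ + Real.log (Fintype.card Γ))} ≤ 4 * eexp (-(2 * τ)) := by
  set ℓ := τ + Real.log (Fintype.card Γ) with hℓdef
  have hc1 : (1 : ℝ) ≤ Fintype.card Γ := by exact_mod_cast Fintype.card_pos
  have hℓ : 0 ≤ ℓ := add_nonneg hτ (Real.log_nonneg hc1)
  have hsub : {ξ : Γ → ℝ | ¬ ∀ ψ : AddChar Γ ℂ, ‖∑ j, ((ξ j * v j : ℝ) : ℂ) * ψ j‖ ^ 2 ≤ 8 * ℓ}
      ⊆ ⋃ ψ : AddChar Γ ℂ, ({ξ | 2 * √ℓ ≤ |∑ j, (v j * (ψ j).re) * ξ j|} ∪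
        {ξ | 2 * √ℓ ≤ |∑ j, (v j * (ψ j).im) * ξ j|}) := by
    intro ξ hξ
    simp only [Set.mem_ofPred_eq, not_forall, not_le] at hξ
    obtain ⟨ψ, hψ⟩ := hξ
    refine Set.mem_iUnion.2 ⟨ψ, ?_⟩
    by_contra hcon
    simp only [Set.mem_union, Set.mem_ofPred_eq, not_or, not_le] at hcon
    have hre : (∑ j, ((ξ j * v j : ℝ) : ℂ) * ψ j).re = ∑ j, (v j * (ψ j).re) * ξ j := by
      rw [Complex.re_sum]
      refine Finset.sum_congr rfl fun j _ => ?_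
      rw [Complex.re_ofReal_mul]
      ring
    have him : (∑ j, ((ξ j * v j : ℝ) : ℂ) * ψ j).im = ∑ j, (v j * (ψ j).im) * ξ j := by
      rw [Complex.im_sum]
      refine Finset.sum_congr rfl fun j _ => ?_
      rw [Complex.im_ofReal_mul]
      ring
    rw [Complex.sq_norm, Complex.normSq_apply, hre, him] at hψ
    have hsq := Real.sq_sqrt hℓ
    have h1 := sq_lt_sq' (neg_lt_of_abs_lt hcon.1) (lt_of_abs_lt hcon.1)
    have h2 := sq_lt_sq' (neg_lt_of_abs_lt hcon.2) (lt_of_abs_lt hcon.2)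
    rw [mul_pow, hsq] at h1 h2
    linarith
  have hpart : ∀ (ψ : AddChar Γ ℂ) (g : ℂ → ℝ), (∀ w, |g w| ≤ ‖w‖) →
      ∑ j, (v j * g (ψ j)) ^ 2 ≤ 1 := by
    intro ψ g hg
    refine le_trans (Finset.sum_le_sum fun j _ => ?_) hv
    have h1 := hg (ψ j)
    rw [AddChar.norm_apply] at h1
    have h2 : g (ψ j) ^ 2 ≤ 1 := by rwa [sq_le_one_iff_abs_le_one]
    rw [mul_pow]
    exact mul_le_of_le_one_right (sq_nonneg _) h2
  have hcard : (Fintype.card Γ : ENNReal) * eexp (-(2 * ℓ)) ≤ eexp (-(2 * τ)) := by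
    rw [show (Fintype.card Γ : ENNReal) = eexp (Real.log (Fintype.card Γ)) by
      rw [eexp, Real.exp_log (by linarith), ENNReal.ofReal_natCast], ← eexp_add]
    refine eexp_le_eexp ?_
    have := Real.log_nonneg hc1
    rw [hℓdef]
    linarith
  calc _ ≤ _ := measure_mono hsub
    _ ≤ ∑ ψ : AddChar Γ ℂ, (2 * eexp (-(2 * ℓ)) + 2 * eexp (-(2 * ℓ))) := by
      refine (measure_iUnion_fintype_le _ _).trans (Finset.sum_le_sum fun ψ _ => ?_)
      refine (measure_union_le _ _).trans (add_le_add ?_ ?_)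
      · exact rademacher_sum_tail_le (hpart ψ Complex.re Complex.abs_re_le_norm) hℓ
      · exact rademacher_sum_tail_le (hpart ψ Complex.im Complex.abs_im_le_norm) hℓ
    _ = 4 * (Fintype.card Γ * eexp (-(2 * ℓ))) := by
      rw [Finset.sum_const, Finset.card_univ, AddChar.card_eq, nsmul_eq_mul]
      ring
    _ ≤ _ := by gcongr

/-- Tail of the correlation of two randomly signed vectors at a nonzero lag. -/
lemma rademacher_correlation_tail_le {a b : Γ → ℝ} {ρ : ℝ} (hρ : 0 < ρ) (ha : ∀ j, |a j| ≤ ρ)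
    (hb : ∑ j, b j ^ 2 ≤ 1) {i i' : Γ} (hi : i ≠ i') {ℓ : ℝ} (hℓ : 0 ≤ ℓ) :
    (Measure.pi fun _ : Γ => rademacherLaw)
      {ξ | 8 * ρ * √ℓ ≤ |∑ k, ξ (k + i) * a (k + i) * (ξ (k + i') * b (k + i'))|}
      ≤ 2 * eexp (-(2 * ℓ)) := by
  classical
  set d := i' - i with hd
  have hd0 : d ≠ 0 := sub_ne_zero.2 hi.symm
  let c : Γ → Γ → ℝ := fun j k => if k = j + d then a j * b k else 0
  have hsum : ∀ ξ : Γ → ℝ, ∑ k, ξ (k + i) * a (k + i) * (ξ (k + i') * b (k + i'))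
      = ∑ j, ∑ k, c j k * ξ j * ξ k := by
    intro ξ
    rw [← Equiv.sum_comp (Equiv.addRight i) fun j => ∑ k, c j k * ξ j * ξ k]
    refine Finset.sum_congr rfl fun k _ => ?_
    simp only [c, Equiv.coe_addRight, ite_mul, zero_mul, Finset.sum_ite_eq',
      Finset.mem_univ, if_true]
    rw [show k + i + d = k + i' by rw [hd]; abel]
    ring
  have hB : ∀ r : ℝ, r ^ 2 = ℓ / (4 * ρ ^ 2) →
      ∫⁻ ξ, eexp (r * ∑ k, ξ (k + i) * a (k + i) * (ξ (k + i') * b (k + i')))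
        ∂(Measure.pi fun _ : Γ => rademacherLaw) ≤ eexp (2 * ℓ) := by
    intro r hr
    simp_rw [hsum, Finset.mul_sum, ← mul_assoc]
    refine lintegral_eexp_quadratic_le rademacherLaw (φ := fun x => x) (ψ := fun x => x)
      measurable_id measurable_id lintegral_eexp_rademacher_le (fun j k => r * c j k)
      (fun j => by simp [c, hd0]) fun ε => ?_
    have hpt : ∀ᵐ ξ ∂(Measure.pi fun _ : Γ => rademacherLaw),
        eexp (8 * ∑ j, (∑ k, if ε j ∧ ¬ ε k then r * c j k * ξ k else 0) ^ 2) ≤ eexp (2 * ℓ) := by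
      filter_upwards [ae_pi_rademacherLaw (Γ := Γ)] with ξ hξ
      refine eexp_le_eexp ?_
      have h1 : ∀ j, (∑ k, if ε j ∧ ¬ ε k then r * c j k * ξ k else 0) ^ 2
          ≤ r ^ 2 * ρ ^ 2 * b (j + d) ^ 2 := by
        intro j
        rw [Finset.sum_eq_single (j + d)]
        · have h2 : ξ (j + d) ^ 2 = 1 := by rcases hξ (j + d) with h | h <;> simp [h]
          have h3 : a j ^ 2 ≤ ρ ^ 2 := by
            rw [← sq_abs]; exact pow_le_pow_left₀ (abs_nonneg _) (ha j) 2
          split_ifs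
          · simp only [c, if_true]
            have : (r * (a j * b (j + d)) * ξ (j + d)) ^ 2
                = r ^ 2 * a j ^ 2 * b (j + d) ^ 2 := by
              rw [mul_pow, h2]; ring
            rw [this]
            gcongr
          · rw [zero_pow two_ne_zero]; positivity
        · intro k _ hk
          simp [c, hk]
        · simp
      have h4 : ∑ j, b (j + d) ^ 2 ≤ 1 :=
        (Equiv.sum_comp (Equiv.addRight d) fun j => b j ^ 2).trans_le hb
      have h5 : r ^ 2 * ρ ^ 2 = ℓ / 4 := by rw [hr]; field_simp
      calc 8 * ∑ j, (∑ k, if ε j ∧ ¬ ε k then r * c j k * ξ k else 0) ^ 2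
          ≤ 8 * ∑ j, r ^ 2 * ρ ^ 2 * b (j + d) ^ 2 := by gcongr with j; exact h1 j
        _ = 2 * ℓ * ∑ j, b (j + d) ^ 2 := by rw [← Finset.mul_sum, h5]; ring
        _ ≤ 2 * ℓ * 1 := by gcongr
        _ = 2 * ℓ := mul_one _
    refine (lintegral_mono_ae hpt).trans ?_
    simp
  have hsq := Real.sq_sqrt hℓ
  have hr : (√ℓ / (2 * ρ)) ^ 2 = ℓ / (4 * ρ ^ 2) := by rw [div_pow, hsq]; ring
  refine (measure_abs_le_eexp_mul_lintegral _ (by fun_prop) (s := √ℓ / (2 * ρ)) (by positivity) _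
    (hB _ hr) (hB _ (by rw [neg_sq]; exact hr))).trans (le_of_eq ?_)
  rw [← eexp_add]
  congr 2
  have : √ℓ / (2 * ρ) * (8 * ρ * √ℓ) = 4 * √ℓ ^ 2 := by field_simp; ring
  rw [this, hsq]
  ring

end Rademacher

/-! ### The dual family of nearly orthonormal vectors -/

section Frobenius

open scoped Matrix.Norms.Frobenius

variable {ι : Type*} [Fintype ι]

lemma frobenius_norm_sq (A : Matrix ι ι ℝ) : ‖A‖ ^ 2 = ∑ i, ∑ j, A i j ^ 2 := by
  rw [Matrix.frobenius_norm_def, ← Real.sqrt_eq_rpow, Real.sq_sqrt (by positivity)]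
  simp

lemma abs_trace_mul_le (A B : Matrix ι ι ℝ) : |(A * B).trace| ≤ ‖A‖ * ‖B‖ := by
  have h1 : (A * B).trace = ∑ q : ι × ι, A q.1 q.2 * B q.2 q.1 := by
    rw [Fintype.sum_prod_type]
    simp [Matrix.trace, Matrix.mul_apply]
  have h2 := Finset.sum_mul_sq_le_sq_mul_sq Finset.univ (fun q : ι × ι => A q.1 q.2)
    (fun q => B q.2 q.1)
  rw [← h1, Fintype.sum_prod_type, Fintype.sum_prod_type_right] at h2
  simp only [← frobenius_norm_sq, ← mul_pow] at h2
  exact abs_le_of_sq_le_sq h2 (by positivity)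

lemma frobenius_norm_le_of_entries [DecidableEq ι] {A : Matrix ι ι ℝ} {ε : ℝ} (hε : 0 ≤ ε)
    (hd : ∀ i, A i i = 0) (ho : ∀ i j, i ≠ j → |A i j| ≤ ε) : ‖A‖ ≤ Fintype.card ι * ε := by
  refine abs_le_of_sq_le_sq' ?_ (by positivity) |>.2
  rw [frobenius_norm_sq]
  calc ∑ i, ∑ j, A i j ^ 2 ≤ ∑ _i : ι, ∑ _j : ι, ε ^ 2 := by
        refine Finset.sum_le_sum fun i _ => Finset.sum_le_sum fun j _ => ?_
        rw [sq_le_sq, abs_of_nonneg hε]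
        rcases eq_or_ne i j with rfl | h
        · simpa [hd] using hε
        · exact ho i j h
    _ = _ := by simp; ring

variable [DecidableEq ι]

lemma exists_left_inverse {G : Matrix ι ι ℝ} (hG : ‖G - 1‖ ≤ 1 / 4) :
    ∃ H : Matrix ι ι ℝ, H * G = 1 := by
  have h1 : ‖1 - G‖ < 1 := by rw [norm_sub_rev]; linarith
  have h2 : IsUnit (1 - (1 - G)) := isUnit_one_sub_of_norm_lt_one h1
  rw [sub_sub_cancel] at h2
  obtain ⟨H, hH⟩ := h2.exists_left_inv
  exact ⟨H, hH⟩

/-- If `G - 1` and `X - α` are small in Frobenius norm with vanishing diagonals, then so is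
`G⁻¹ X - α`, and its trace is of second order. -/
lemma inverse_mul_sub_small {G H X : Matrix ι ι ℝ} {α : ℝ} (hHG : H * G = 1)
    (hG : ‖G - 1‖ ≤ 1 / 4) (hX : ‖X - α • 1‖ ≤ 1 / 4) (hα : |α| ≤ 1)
    (hGd : ∀ i, (G - 1) i i = 0) (hXd : ∀ i, (X - α • (1 : Matrix ι ι ℝ)) i i = 0) :
    ‖H * X - α • 1‖ ≤ 1 ∧ |(H * X - α • 1).trace| ≤ 1 := by
  set D := G - 1 with hD
  set Y := X - α • (1 : Matrix ι ι ℝ) with hY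
  set J := H - 1 with hJ
  -- The first-order part `-D` of `G⁻¹ - 1` is traceless.
  have hJeq : J = -D - J * D := by
    have : H * D = 1 - H := by rw [hD, mul_sub, hHG, mul_one]
    rw [hJ, sub_mul, one_mul, this]
    abel
  have hJn : ‖J‖ ≤ 1 / 3 := by
    have h1 : ‖J‖ ≤ ‖D‖ + ‖J‖ * ‖D‖ := by
      calc ‖J‖ = ‖-D - J * D‖ := by rw [← hJeq]
        _ ≤ ‖-D‖ + ‖J * D‖ := norm_sub_le _ _
        _ ≤ _ := by rw [norm_neg]; gcongr; exact norm_mul_le _ _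
    nlinarith [norm_nonneg J, norm_nonneg D]
  have hDtr : D.trace = 0 := Finset.sum_eq_zero fun i _ => hGd i
  have hYtr : Y.trace = 0 := Finset.sum_eq_zero fun i _ => hXd i
  have hprod : H * X - α • 1 = Y + α • J + J * Y := by
    have e1 : H = 1 + J := by rw [hJ]; abel
    have e2 : X = Y + α • 1 := by rw [hY]; abel
    rw [e1, e2, add_mul, one_mul, mul_add, mul_smul_comm, mul_one]
    abel
  have hJtr : |J.trace| ≤ 1 / 12 := by
    rw [hJeq, Matrix.trace_sub, Matrix.trace_neg, hDtr, neg_zero, zero_sub, abs_neg]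
    refine (abs_trace_mul_le J D).trans ?_
    nlinarith [norm_nonneg J, norm_nonneg D]
  have hJY : ‖J‖ * ‖Y‖ ≤ 1 / 12 := by nlinarith [norm_nonneg J, norm_nonneg Y]
  constructor
  · rw [hprod]
    have h1 := norm_add_le (Y + α • J) (J * Y)
    have h2 := norm_add_le Y (α • J)
    have h3 : ‖α • J‖ ≤ 1 / 3 := by
      rw [norm_smul, Real.norm_eq_abs]
      nlinarith [norm_nonneg J, abs_nonneg α]
    have h4 := norm_mul_le J Y
    linarith
  · rw [hprod, Matrix.trace_add, Matrix.trace_add, hYtr, zero_add, Matrix.trace_smul, smul_eq_mul]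
    refine (abs_add_le _ _).trans ?_
    have h1 := abs_trace_mul_le J Y
    have h2 : |α * J.trace| ≤ 1 / 12 := by
      rw [abs_mul]
      nlinarith [abs_nonneg J.trace, abs_nonneg α]
    linarith

end Frobenius

/-! ### Observation models as random signs -/

lemma measurable_sgn : Measurable sgn :=
  Measurable.ite measurableSet_Ici measurable_const measurable_const

lemma sgn_eq_or (z : ℝ) : sgn z = 1 ∨ sgn z = -1 := by
  unfold sgn; split_ifs <;> simp

lemma measurePreserving_neg_gaussian :
    MeasurePreserving (fun x : ℝ => -x) (gaussianReal 0 1) (gaussianReal 0 1) :=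
  ⟨measurable_neg, by rw [gaussianReal_map_neg, neg_zero]⟩

lemma integral_comp_neg_gaussian (f : ℝ → ℝ) :
    ∫ x, f (-x) ∂(gaussianReal 0 1) = ∫ x, f x ∂(gaussianReal 0 1) :=
  measurePreserving_neg_gaussian.integral_comp (MeasurableEquiv.neg ℝ).measurableEmbedding f

lemma integrable_of_sign {α : Type*} [MeasurableSpace α] (μ : Measure α) [IsFiniteMeasure μ]
    {f : α → ℝ} (hf : Measurable f) (h1 : ∀ x, f x = 1 ∨ f x = -1) : Integrable f μ := by
  refine Integrable.of_bound hf.aestronglyMeasurable 1 (.of_forall fun x => ?_)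
  rcases h1 x with h | h <;> simp [h]

lemma ae_ne_gaussian (y : ℝ) : ∀ᵐ x ∂(gaussianReal 0 1), x ≠ y := by
  have := nullSingletonClass_gaussianReal (μ := 0) (v := 1) one_ne_zero
  rw [ae_iff]
  simp

lemma integral_sgn_gaussian : ∫ x, sgn x ∂(gaussianReal 0 1) = 0 := by
  have h1 := integral_comp_neg_gaussian sgn
  have h2 : ∫ x, sgn (-x) ∂(gaussianReal 0 1) = ∫ x, -sgn x ∂(gaussianReal 0 1) := by
    refine integral_congr_ae ?_
    filter_upwards [ae_ne_gaussian 0] with x hx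
    unfold sgn
    rcases lt_or_gt_of_ne hx with h | h
    · rw [if_pos (by linarith), if_neg (by linarith)]; ring
    · rw [if_neg (by linarith), if_pos h.le]
  rw [h2, integral_neg] at h1
  linarith

/-- Both observation models produce symmetric random signs: under noise with `F(u) + F(-u) = 1`
this is the identity `E F(g) = 1 / 2` for a symmetric `g`. The flip `τ` equals `± 1` only almost
surely, hence the exceptional null set. -/
lemma exists_sign_of_isObservationModel {θ : ℝ → ℝ → ℝ} {ν : Measure ℝ}
    (h : IsObservationModel θ ν) : IsProbabilityMeasure ν ∧ ∃ β : ℝ × ℝ → ℝ, Measurable β ∧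
      (∀ q, β q = 1 ∨ β q = -1) ∧ (∀ᵐ w ∂ν, ∀ z, θ w z = β (w, z)) ∧
      ∫ q, β q ∂(ν.prod (gaussianReal 0 1)) = 0 := by
  rcases h with ⟨rfl, p, hp0, hp1, rfl⟩ | ⟨rfl, hν, hcdf⟩
  · have hprob : IsProbabilityMeasure (flipLaw p) := by
      refine ⟨?_⟩
      simp only [flipLaw, Measure.coe_add, Measure.coe_smul, Pi.add_apply, Pi.smul_apply,
        measure_univ, smul_eq_mul, mul_one]
      rw [← ENNReal.ofReal_add (by linarith) hp0]
      norm_num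
    have hms := measurable_sgn
    refine ⟨hprob, fun q => sgn q.1 * sgn q.2, by fun_prop, fun q => ?_, ?_, ?_⟩
    · rcases sgn_eq_or q.1 with h | h <;> rcases sgn_eq_or q.2 with h' | h' <;> simp [h, h']
    · rw [flipLaw, ae_add_measure_iff]
      constructor <;>
      · refine Measure.ae_smul_measure ?_ _
        rw [Filter.Eventually, ae_dirac_eq, Filter.mem_pure]
        intro z
        have h10 : ¬ (1 : ℝ) ≤ 0 := by norm_num
        simp [bitFlip, sgn, h10]
    · rw [integral_prod_mul (f := sgn) (g := sgn), integral_sgn_gaussian, mul_zero]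
  · have hms := measurable_sgn
    have hsm : Measurable fun q : ℝ × ℝ => sgn (q.2 + q.1) := by fun_prop
    refine ⟨hν, fun q => sgn (q.2 + q.1), hsm, fun q => sgn_eq_or _, .of_forall fun w z => rfl, ?_⟩
    have hm' : Measurable fun q : ℝ × ℝ => (Set.Iic (-q.2)).indicator (fun _ => (1 : ℝ)) q.1 := by
      have : (fun q : ℝ × ℝ => (Set.Iic (-q.2)).indicator (fun _ => (1 : ℝ)) q.1)
          = {q : ℝ × ℝ | q.1 ≤ -q.2}.indicator fun _ => 1 := by
        ext q; simp [Set.indicator]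
      rw [this]
      exact measurable_const.indicator (measurableSet_le (by fun_prop) (by fun_prop))
    have hcongr : ∫ q, sgn (q.2 + q.1) ∂(ν.prod (gaussianReal 0 1))
        = ∫ q, (1 - 2 * (Set.Iic (-q.2)).indicator (fun _ => (1 : ℝ)) q.1)
          ∂(ν.prod (gaussianReal 0 1)) := by
      refine integral_congr_ae ?_
      rw [Filter.EventuallyEq, Measure.ae_prod_iff_ae_ae
        (measurableSet_eq_fun hsm (by fun_prop))]
      refine .of_forall fun e => ?_
      filter_upwards [ae_ne_gaussian (-e)] with z hz
      unfold sgn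
      rcases lt_or_gt_of_ne hz with h | h
      · rw [if_neg (by linarith), Set.indicator_of_mem (by rw [Set.mem_Iic]; linarith)]
        norm_num
      · rw [if_pos (by linarith), Set.indicator_of_notMem (by rw [Set.mem_Iic]; linarith)]
        norm_num
    have hint : Integrable (fun q : ℝ × ℝ =>
        1 - 2 * (Set.Iic (-q.2)).indicator (fun _ => (1 : ℝ)) q.1)
        (ν.prod (gaussianReal 0 1)) := by
      refine integrable_of_sign _ (by fun_prop) fun q => ?_
      by_cases hq : q.1 ∈ Set.Iic (-q.2)
      · right; rw [Set.indicator_of_mem hq]; norm_num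
      · left; rw [Set.indicator_of_notMem hq]; norm_num
    have hinner : ∀ z : ℝ, ∫ e, (1 - 2 * (Set.Iic (-z)).indicator (fun _ => (1 : ℝ)) e) ∂ν
        = 1 - 2 * cdf ν (-z) := by
      intro z
      rw [integral_sub (integrable_const _)
        (((integrable_const 1).indicator measurableSet_Iic).const_mul 2), integral_const_mul,
        integral_indicator_const _ measurableSet_Iic, cdf_eq_real]
      simp
    have hcm : Measurable (cdf ν) := (cdf ν).mono.measurable
    have hci : Integrable (cdf ν) (gaussianReal 0 1) := by
      refine Integrable.of_bound hcm.aestronglyMeasurable 1 (.of_forall fun x => ?_)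
      rw [Real.norm_eq_abs, abs_of_nonneg (cdf_nonneg ν x)]
      exact cdf_le_one ν x
    have hcin : Integrable (fun z => cdf ν (-z)) (gaussianReal 0 1) :=
      measurePreserving_neg_gaussian.integrable_comp_of_integrable hci
    have hsum : ∫ z, (cdf ν z + cdf ν (-z)) ∂(gaussianReal 0 1) = 1 := by simp [hcdf]
    rw [integral_add hci hcin, integral_comp_neg_gaussian] at hsum
    rw [hcongr, integral_prod_symm _ hint]
    simp_rw [hinner]
    rw [integral_sub (integrable_const _) (hcin.const_mul 2), integral_const_mul,
      integral_comp_neg_gaussian]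
    simp
    linarith

/-! ### The conditional tail bound given the signs -/

section Conditional

open scoped Matrix.Norms.Frobenius

variable {E : Type*} [NormedAddCommGroup E] [InnerProductSpace ℝ E] [FiniteDimensional ℝ E]
  [MeasurableSpace E] [BorelSpace E] {ι : Type*} [Fintype ι] [DecidableEq ι]

/-- Tail bound for Gaussian measurements whose directions `p i` are nearly orthonormal and whose
cross correlations with `u j` are nearly diagonal. -/
theorem conditional_tail_le {ν : Measure ℝ} [IsProbabilityMeasure ν] {β : ℝ × ℝ → ℝ}
    (hβ : Measurable β) (hβ1 : ∀ q, β q = 1 ∨ β q = -1)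
    (hβ0 : ∫ q, β q ∂(ν.prod (gaussianReal 0 1)) = 0) (p u : ι → E) {α ε : ℝ} (hε : 0 ≤ ε)
    (hεm : Fintype.card ι * ε ≤ 1 / 4) (hα : |α| ≤ 1) (hpd : ∀ i, inner ℝ (p i) (p i) = (1 : ℝ))
    (hpo : ∀ i j, i ≠ j → |inner ℝ (p i) (p j)| ≤ ε) (hud : ∀ i, inner ℝ (p i) (u i) = α)
    (huo : ∀ i j, i ≠ j → |inner ℝ (p i) (u j)| ≤ ε) (hu : ∀ i, ‖u i‖ ≤ 1) {s ℓ y : ℝ}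
    (hs0 : 0 ≤ s) (hs : s ^ 2 ≤ 1 / 64) (hsℓ : s ^ 2 * ℓ ≤ 1 / 64)
    (hL : ∀ z, ∑ i, inner ℝ z (u i) ^ 2 ≤ 8 * ℓ * ‖z‖ ^ 2) :
    ((stdGaussian E).prod (Measure.pi fun _ : ι => ν))
      {q | 3 * y + 1 ≤ |∑ i, β (q.2 i, inner ℝ q.1 (p i)) * inner ℝ q.1 (u i)
        - Fintype.card ι * (α * ∫ r, β r * r.2 ∂(ν.prod (gaussianReal 0 1)))|}
      ≤ 2 * (6 * eexp (24 * s ^ 2 * Fintype.card ι - s * y)) ^ (1 / 2 : ℝ) := by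
  set lam := ∫ r, β r * r.2 ∂(ν.prod (gaussianReal 0 1)) with hlam
  set m : ℝ := (Fintype.card ι : ℝ) with hm
  let G : Matrix ι ι ℝ := Matrix.of fun i j => inner ℝ (p i) (p j)
  let X : Matrix ι ι ℝ := Matrix.of fun i j => inner ℝ (p i) (u j)
  have hGd : ∀ i, (G - 1) i i = 0 := fun i => by
    simp only [G, Matrix.sub_apply, Matrix.of_apply, Matrix.one_apply_eq, hpd, sub_self]
  have hXd : ∀ i, (X - α • (1 : Matrix ι ι ℝ)) i i = 0 := fun i => by simp [X, hud]
  have hG4 : ‖G - 1‖ ≤ 1 / 4 := by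
    refine (frobenius_norm_le_of_entries hε hGd fun i j hij => ?_).trans hεm
    simpa [G, Matrix.one_apply, hij] using hpo i j hij
  have hX4 : ‖X - α • 1‖ ≤ 1 / 4 := by
    refine (frobenius_norm_le_of_entries hε hXd fun i j hij => ?_).trans hεm
    simpa [X, Matrix.one_apply, hij] using huo i j hij
  obtain ⟨H, hHG⟩ := exists_left_inverse hG4
  obtain ⟨hN, hNtr⟩ := inverse_mul_sub_small hHG hG4 hX4 hα hGd hXd
  have hGij : ∀ i j, G i j = inner ℝ (p i) (p j) := fun _ _ => rfl
  let a : ι → E := fun i => ∑ j, H i j • p j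
  have ha : ∀ i, a i = ∑ j, H i j • p j := fun _ => rfl
  have hau : ∀ i j, inner ℝ (u i) (a j) = (H * X) j i := by
    intro i j
    rw [ha, inner_sum, Matrix.mul_apply]
    refine Finset.sum_congr rfl fun k _ => ?_
    rw [real_inner_smul_right, real_inner_comm]
    rfl
  have hap : ∀ i j, inner ℝ (a i) (p j) = if i = j then 1 else 0 := by
    intro i j
    rw [ha, sum_inner, ← Matrix.one_apply, ← hHG, Matrix.mul_apply]
    exact Finset.sum_congr rfl fun k _ => by rw [real_inner_smul_left]; rfl
  have hNF : ∑ i, ∑ j, (H * X - α • 1) i j ^ 2 ≤ 1 := by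
    rw [← frobenius_norm_sq]
    exact pow_le_one₀ (norm_nonneg _) hN
  have hR : ∀ t, ‖(dualResidual p a).adjoint t‖ ≤ ‖t‖ := by
    intro t
    have h1 := norm_sq_eq_add_residual hGij hHG ha t
    rw [← adjoint_dualResidual_apply] at h1
    exact abs_le_of_sq_le_sq' (by nlinarith [sq_nonneg ‖∑ i, inner ℝ (a i) t • p i‖])
      (norm_nonneg t) |>.2
  have hRp : ∀ z i, inner ℝ (dualResidual p a z) (p i) = 0 := by
    intro z i
    rw [dualResidual_apply, inner_sub_left, sum_inner]
    simp_rw [real_inner_smul_left, hap]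
    simp [real_inner_comm]
  have hF : ∑ i, ∑ j, (G - 1) i j ^ 2 ≤ 1 / 16 := by
    rw [← frobenius_norm_sq]
    nlinarith [norm_nonneg (G - 1)]
  let B : Set (E × (ι → ℝ)) := {q | 3 * y + 1 ≤
    |∑ i, β (q.2 i, inner ℝ q.1 (p i)) * inner ℝ q.1 (u i) - m * (α * lam)|}
  have hB : MeasurableSet B := by
    refine measurableSet_le measurable_const ?_
    refine Measurable.norm (f := fun q : E × (ι → ℝ) =>
      ∑ i, β (q.2 i, inner ℝ q.1 (p i)) * inner ℝ q.1 (u i) - m * (α * lam)) ?_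
    fun_prop
  let Φ : E → ENNReal := fun z => (Measure.pi fun _ : ι => ν) (Prod.mk z ⁻¹' B)
  have hΦ : Measurable Φ := measurable_measure_prodMk_left hB
  have hcom := lintegral_stdGaussian_le_of_gram hGij hHG ha hF hΦ fun z => prob_le_one
  change ((stdGaussian E).prod (Measure.pi fun _ : ι => ν)) B ≤ _
  rw [Measure.prod_apply hB]
  refine hcom.trans ?_
  gcongr
  let B' : Set ((ι → ℝ × ℝ) × E) := {q | 3 * y + 1 ≤
    |∑ i, β (q.1 i) * inner ℝ (∑ j, (q.1 j).2 • a j + dualResidual p a q.2) (u i)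
      - m * (α * lam)|}
  have hB' : MeasurableSet B' := by
    refine measurableSet_le measurable_const ?_
    refine Measurable.norm (f := fun q : (ι → ℝ × ℝ) × E =>
      ∑ i, β (q.1 i) * inner ℝ (∑ j, (q.1 j).2 • a j + dualResidual p a q.2) (u i)
        - m * (α * lam)) ?_
    fun_prop
  have href := reference_tail_le (ν.prod (gaussianReal 0 1)) (h := fun r : ℝ × ℝ => r.2) hβ hβ1
    hβ0 measurePreserving_snd u a (dualResidual p a) hR (α := α) (y := y) hs0 hs hsℓ hL hu ?_ ?_ ?_
  · refine le_trans (le_of_eq ?_) href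
    change _ = ((Measure.pi fun _ : ι => ν.prod (gaussianReal 0 1)).prod (stdGaussian E)) B'
    rw [Measure.prod_apply hB']
    have hmk : Measurable fun x : (ι → ℝ) × (ι → ℝ) =>
        (stdGaussian E) (Prod.mk (fun i => (x.1 i, x.2 i)) ⁻¹' B') := by
      have hf : Measurable fun q : ι → ℝ × ℝ => (stdGaussian E) (Prod.mk q ⁻¹' B') :=
        measurable_measure_prodMk_left hB'
      have hg : Measurable fun (x : (ι → ℝ) × (ι → ℝ)) (i : ι) => (x.1 i, x.2 i) := by fun_prop
      exact hf.comp hg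
    have h1 := (measurePreserving_arrowProdEquivProdArrow ℝ ℝ ι (fun _ => ν)
      (fun _ => gaussianReal 0 1)).lintegral_comp hmk
    change ∫⁻ x : ι → ℝ × ℝ, (stdGaussian E) (Prod.mk x ⁻¹' B') ∂_ = _ at h1
    -- Both sides are integrals over `h`, `z` and the noise; on the reference vector the
    -- functionals `⟪·, p i⟫` take the values `h i`.
    rw [h1, lintegral_prod_symm _ hmk.aemeasurable]
    refine lintegral_congr fun h => ?_
    have hBh : MeasurableSet {q : (ι → ℝ) × E | ((fun i => (q.1 i, h i)), q.2) ∈ B'} :=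
      hB'.preimage (by fun_prop)
    have h2 : ∀ w : ι → ℝ, (Prod.mk (fun i => (w i, h i)) ⁻¹' B' : Set E)
        = Prod.mk w ⁻¹' {q : (ι → ℝ) × E | ((fun i => (q.1 i, h i)), q.2) ∈ B'} := fun w => rfl
    simp only [h2]
    rw [← Measure.prod_apply hBh, Measure.prod_apply_symm hBh]
    refine lintegral_congr fun z => ?_
    refine congrArg (Measure.pi fun _ : ι => ν) (Set.ext fun w => ?_)
    have h3 : ∀ i, inner ℝ (∑ j, h j • a j + dualResidual p a z) (p i) = h i := by
      intro i
      rw [inner_add_left, hRp, add_zero, sum_inner]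
      simp_rw [real_inner_smul_left, hap]
      simp
    simp only [B, B', Set.mem_preimage, Set.mem_ofPred_eq, h3]
  · intro i
    have h1 : (H * X - α • 1) i i ^ 2 ≤ 1 :=
      (Finset.single_le_sum (f := fun j => (H * X - α • 1) i j ^ 2) (fun _ _ => sq_nonneg _)
        (Finset.mem_univ i)).trans ((Finset.single_le_sum
          (f := fun i => ∑ j, (H * X - α • 1) i j ^ 2) (fun _ _ => by positivity)
          (Finset.mem_univ i)).trans hNF)
    rw [hau]
    rw [sq_le_one_iff_abs_le_one] at h1
    have h2 : (H * X) i i = (H * X - α • 1) i i + α := by simp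
    rw [h2]
    exact (abs_add_le _ _).trans (by linarith)
  · rw [Finset.sum_comm]
    refine le_trans (Finset.sum_le_sum fun j _ => Finset.sum_le_sum fun i _ => ?_) hNF
    rcases eq_or_ne i j with rfl | hij
    · simpa using sq_nonneg _
    · rw [if_neg hij, hau]
      simp [hij.symm]
  · convert hNtr using 2
    simp only [Matrix.trace, Matrix.diag]
    exact Finset.sum_congr rfl fun i _ => by simp [hau]

/-- The conditional tail bound with the exponent optimized. The choice
`s ^ 2 = min (τ / m) (1 / ℓ) / 64` keeps the exponential moments below `e ^ τ` and makes
`s √(m ℓ)` at least `τ / 8`, because `τ ≤ ℓ` and `τ ^ 2 ≤ m`. -/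
theorem conditional_tail_le_exp {ν : Measure ℝ} [IsProbabilityMeasure ν] {β : ℝ × ℝ → ℝ}
    (hβ : Measurable β) (hβ1 : ∀ q, β q = 1 ∨ β q = -1)
    (hβ0 : ∫ q, β q ∂(ν.prod (gaussianReal 0 1)) = 0) (p u : ι → E) {α ε : ℝ} (hε : 0 ≤ ε)
    (hεm : Fintype.card ι * ε ≤ 1 / 4) (hα : |α| ≤ 1) (hpd : ∀ i, inner ℝ (p i) (p i) = (1 : ℝ))
    (hpo : ∀ i j, i ≠ j → |inner ℝ (p i) (p j)| ≤ ε) (hud : ∀ i, inner ℝ (p i) (u i) = α)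
    (huo : ∀ i j, i ≠ j → |inner ℝ (p i) (u j)| ≤ ε) (hu : ∀ i, ‖u i‖ ≤ 1) {τ ℓ : ℝ}
    (hτ : 1 ≤ τ) (hτℓ : τ ≤ ℓ) (hτm : τ ^ 2 ≤ Fintype.card ι)
    (hL : ∀ z, ∑ i, inner ℝ z (u i) ^ 2 ≤ 8 * ℓ * ‖z‖ ^ 2) :
    ((stdGaussian E).prod (Measure.pi fun _ : ι => ν))
      {q | 121 * √(Fintype.card ι * ℓ) ≤ |∑ i, β (q.2 i, inner ℝ q.1 (p i)) * inner ℝ q.1 (u i)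
        - Fintype.card ι * (α * ∫ r, β r * r.2 ∂(ν.prod (gaussianReal 0 1)))|}
      ≤ 6 * eexp (-(2 * τ)) := by
  set m : ℝ := (Fintype.card ι : ℝ) with hm
  have hm1 : 1 ≤ m := by nlinarith
  have hℓ1 : 1 ≤ ℓ := hτ.trans hτℓ
  have hm0 : 0 < m := by linarith
  have hℓ0 : 0 < ℓ := by linarith
  set κ := min (τ / m) (1 / ℓ) with hκ
  have hκ0 : 0 ≤ κ := le_min (by positivity) (by positivity)
  have hκm : κ * m ≤ τ := by
    rw [← le_div_iff₀ hm0]; exact min_le_left _ _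
  have hκℓ : κ * ℓ ≤ 1 := by
    rw [← le_div_iff₀ hℓ0]; exact min_le_right _ _
  have hκ1 : κ ≤ 1 := by nlinarith
  have hκy : τ ^ 2 ≤ κ * (m * ℓ) := by
    rw [hκ, min_mul_of_nonneg _ _ (by positivity)]
    refine le_min ?_ ?_
    · rw [show τ / m * (m * ℓ) = τ * ℓ by field_simp]
      nlinarith
    · rw [show 1 / ℓ * (m * ℓ) = m by field_simp]
      exact hτm
  set s := √κ / 8 with hs
  have hs2 : s ^ 2 = κ / 64 := by rw [hs, div_pow, Real.sq_sqrt hκ0]; norm_num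
  have hy : 5 * τ ≤ s * (40 * √(m * ℓ)) := by
    have h1 : τ ≤ √κ * √(m * ℓ) := by
      rw [← Real.sqrt_mul hκ0]
      exact Real.le_sqrt_of_sq_le hκy
    rw [hs]
    linarith
  have hone : 1 ≤ √(m * ℓ) := Real.one_le_sqrt.2 (by nlinarith)
  refine (measure_mono fun q hq => ?_).trans ((conditional_tail_le hβ hβ1 hβ0 p u hε hεm hα hpd hpo
    hud huo hu (s := s) (ℓ := ℓ) (y := 40 * √(m * ℓ)) (by positivity) (by rw [hs2]; linarith)
    (by rw [hs2]; linarith) hL).trans ?_)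
  · have hq' : 121 * √(m * ℓ) ≤ _ := hq
    change 3 * (40 * √(m * ℓ)) + 1 ≤ _
    exact le_trans (by linarith) hq'
  · have h1 : 6 * eexp (24 * s ^ 2 * m - s * (40 * √(m * ℓ)))
        ≤ (3 * eexp (-(2 * τ))) ^ (2 : ℝ) := by
      rw [ENNReal.mul_rpow_of_nonneg _ _ (by norm_num), ENNReal.rpow_two, ENNReal.rpow_two,
        sq (eexp _), ← eexp_add]
      gcongr
      · norm_num
      · refine eexp_le_eexp ?_
        rw [hs2]
        nlinarith
    calc 2 * (6 * eexp (24 * s ^ 2 * m - s * (40 * √(m * ℓ)))) ^ (1 / 2 : ℝ)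
        ≤ 2 * ((3 * eexp (-(2 * τ))) ^ (2 : ℝ)) ^ (1 / 2 : ℝ) := by gcongr
      _ = 6 * eexp (-(2 * τ)) := by
        rw [← ENNReal.rpow_mul]
        norm_num
        ring

end Conditional

/-! ### Randomly signed shifts -/

section SignedShift

variable {n : ℕ}

/-- The vector `D_ξ x` shifted by `i`; the row products of the sensing matrix are inner products
with it, `⟨a_i, x⟩ = ⟪g, signedShift ξ x i⟫`. -/
noncomputable def signedShift (ξ : Fin n → ℝ) (x : EuclideanSpace ℝ (Fin n)) (i : Fin n) :
    EuclideanSpace ℝ (Fin n) :=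
  WithLp.toLp 2 fun k => ξ (k + i) * x (k + i)

lemma inner_signedShift_right (ξ : Fin n → ℝ) (z x : EuclideanSpace ℝ (Fin n)) (i : Fin n) :
    inner ℝ z (signedShift ξ x i) = ∑ k, z k * (ξ (k + i) * x (k + i)) := by
  simp [signedShift, PiLp.inner_apply, mul_comm]

lemma measurable_inner_signedShift {α : Type*} [MeasurableSpace α] {ξ : α → Fin n → ℝ}
    (hξ : Measurable ξ) {z : α → EuclideanSpace ℝ (Fin n)} (hz : Measurable z)
    (x : EuclideanSpace ℝ (Fin n)) (i : Fin n) :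
    Measurable fun q => inner ℝ (z q) (signedShift (ξ q) x i) := by
  simp_rw [inner_signedShift_right]
  fun_prop

lemma correlationError_smul (θ : ℝ → ℝ → ℝ) (ν : Measure ℝ) (Ω : Finset (Fin n))
    (g ξ : Fin n → ℝ) (w : Ω → ℝ) (x v : EuclideanSpace ℝ (Fin n)) (c : ℝ) :
    correlationError θ ν Ω g ξ w x (c • v) = c * correlationError θ ν Ω g ξ w x v := by
  rw [correlationError, correlationError, Matrix.mulVec_smul, dotProduct_smul,
    smul_eq_mul]

variable [NeZero n]

lemma inner_signedShift_self {ξ : Fin n → ℝ} (hξ : ∀ j, ξ j = 1 ∨ ξ j = -1)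
    (x v : EuclideanSpace ℝ (Fin n)) (i : Fin n) :
    inner ℝ (signedShift ξ x i) (signedShift ξ v i) = inner ℝ x v := by
  rw [inner_signedShift_right, PiLp.inner_apply]
  rw [← Equiv.sum_comp (Equiv.addRight i) fun k => inner ℝ (x k) (v k)]
  refine Finset.sum_congr rfl fun k _ => ?_
  have h : ξ (k + i) * ξ (k + i) = 1 := by rcases hξ (k + i) with h | h <;> simp [h]
  simp only [signedShift, Equiv.coe_addRight]
  calc ξ (k + i) * x (k + i) * (ξ (k + i) * v (k + i))
      = ξ (k + i) * ξ (k + i) * (x (k + i) * v (k + i)) := by ring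
    _ = _ := by rw [h, one_mul]; simp [mul_comm]

lemma sensing_mulVec (Ω : Finset (Fin n)) (g ξ : Fin n → ℝ) (x : EuclideanSpace ℝ (Fin n))
    (i : Ω) : (sensing Ω g ξ *ᵥ x) i = inner ℝ (WithLp.toLp 2 g) (signedShift ξ x i) := by
  rw [inner_signedShift_right, sensing, ← Matrix.mulVec_mulVec]
  simp only [Matrix.mulVec, dotProduct, partialCirc, circ, Matrix.submatrix_apply, Matrix.of_apply,
    Matrix.diagonal_apply, ite_mul, zero_mul, Finset.sum_ite_eq, Finset.mem_univ, if_true, id]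
  rw [← Equiv.sum_comp (Equiv.addRight (i : Fin n))]
  refine Finset.sum_congr rfl fun k _ => ?_
  simp

/-- For signs `ξ`, the correlation error depends on `g` only through the inner products with the
signed shifts of `x` and `v`. -/
lemma correlationError_eq (θ : ℝ → ℝ → ℝ) (ν : Measure ℝ) (Ω : Finset (Fin n)) (g : Fin n → ℝ)
    {ξ : Fin n → ℝ} (hξ : ∀ j, ξ j = 1 ∨ ξ j = -1) (w : Ω → ℝ)
    (x v : EuclideanSpace ℝ (Fin n)) (hΩ : (Ω.card : ℝ) ≠ 0) :
    correlationError θ ν Ω g ξ w x v = (1 / (Ω.card : ℝ)) *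
      (∑ i : Ω, θ (w i) (inner ℝ (WithLp.toLp 2 g) (signedShift ξ x i)) *
        inner ℝ (WithLp.toLp 2 g) (signedShift ξ v i)
          - Ω.card * (inner ℝ x v * obsMean θ ν)) := by
  have h1 : (Matrix.diagonal ξ *ᵥ x.ofLp) ⬝ᵥ (Matrix.diagonal ξ *ᵥ v.ofLp) = inner ℝ x v := by
    rw [PiLp.inner_apply]
    simp only [dotProduct, Matrix.mulVec_diagonal]
    refine Finset.sum_congr rfl fun j _ => ?_
    rcases hξ j with h | h <;> simp [h, mul_comm]
  have h2 : ((partialCirc Ω g)ᵀ *ᵥ observations θ Ω g ξ w x) ⬝ᵥ (Matrix.diagonal ξ *ᵥ v.ofLp)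
      = ∑ i : Ω, θ (w i) (inner ℝ (WithLp.toLp 2 g) (signedShift ξ x i)) *
        inner ℝ (WithLp.toLp 2 g) (signedShift ξ v i) := by
    rw [Matrix.mulVec_transpose, ← Matrix.dotProduct_mulVec, Matrix.mulVec_mulVec, dotProduct]
    refine Finset.sum_congr rfl fun i _ => ?_
    rw [observations, sensing_mulVec]
    congr 1
    exact sensing_mulVec Ω g ξ v i
  rw [correlationError, sub_dotProduct, smul_dotProduct, smul_dotProduct, h1, h2, smul_eq_mul,
    smul_eq_mul]
  field_simp

/-- With high probability all correlations at nonzero lags between points of `Ω` are small. -/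
lemma signedShift_correlation_tail_le (Ω : Finset (Fin n)) (hΩ : Ω.Nonempty)
    {x v : EuclideanSpace ℝ (Fin n)} {ρ : ℝ} (hρ : 0 < ρ) (hx : ∀ j, |x j| ≤ ρ) (hv : ‖v‖ ≤ 1)
    {τ : ℝ} (hτ : 0 ≤ τ) :
    (Measure.pi fun _ : Fin n => rademacherLaw)
      {ξ | ∃ i j : Ω, i ≠ j ∧ 8 * ρ * √(τ + Real.log Ω.card)
        ≤ |inner ℝ (signedShift ξ x i) (signedShift ξ v j)|} ≤ 2 * eexp (-(2 * τ)) := by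
  set ℓ := τ + Real.log Ω.card with hℓdef
  have hc : (1 : ℝ) ≤ Ω.card := by exact_mod_cast hΩ.card_pos
  have hℓ : 0 ≤ ℓ := add_nonneg hτ (Real.log_nonneg hc)
  have hv2 : ∑ j, v j ^ 2 ≤ 1 := by
    rw [← EuclideanSpace.real_norm_sq_eq]
    exact pow_le_one₀ (norm_nonneg _) hv
  have hsub : {ξ : Fin n → ℝ | ∃ i j : Ω, i ≠ j ∧ 8 * ρ * √ℓ
        ≤ |inner ℝ (signedShift ξ x i) (signedShift ξ v j)|}
      ⊆ ⋃ q : Ω × Ω, {ξ | q.1 ≠ q.2 ∧ 8 * ρ * √ℓ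
        ≤ |inner ℝ (signedShift ξ x q.1) (signedShift ξ v q.2)|} := by
    rintro ξ ⟨i, j, h⟩
    exact Set.mem_iUnion.2 ⟨(i, j), h⟩
  have hone : ∀ q : Ω × Ω, (Measure.pi fun _ : Fin n => rademacherLaw) {ξ | q.1 ≠ q.2 ∧
      8 * ρ * √ℓ ≤ |inner ℝ (signedShift ξ x q.1) (signedShift ξ v q.2)|}
      ≤ 2 * eexp (-(2 * ℓ)) := by
    intro q
    by_cases hq : q.1 = q.2
    · simp [hq]
    · have hq' : (q.1 : Fin n) ≠ q.2 := fun h => hq (Subtype.ext h)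
      refine (measure_mono fun ξ hξ => ?_).trans
        (rademacher_correlation_tail_le hρ hx hv2 hq' hℓ)
      have h := hξ.2
      rw [inner_signedShift_right] at h
      exact h
  have hcard : (Ω.card : ENNReal) = eexp (Real.log Ω.card) := by
    rw [eexp, Real.exp_log (by linarith), ENNReal.ofReal_natCast]
  calc _ ≤ _ := measure_mono hsub
    _ ≤ ∑ _q : Ω × Ω, 2 * eexp (-(2 * ℓ)) :=
      (measure_iUnion_fintype_le _ _).trans (Finset.sum_le_sum fun q _ => hone q)
    _ = 2 * ((Ω.card : ENNReal) * Ω.card * eexp (-(2 * ℓ))) := by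
      rw [Finset.sum_const, Finset.card_univ, Fintype.card_prod, Fintype.card_coe, nsmul_eq_mul]
      push_cast
      ring
    _ = 2 * eexp (-(2 * τ)) := by
      rw [hcard, ← eexp_add, ← eexp_add]
      congr 2
      rw [hℓdef]
      ring

/-- Averaging the conditional tail bound over the random signs. -/
theorem joint_tail_le (Ω : Finset (Fin n)) {ν : Measure ℝ} [IsProbabilityMeasure ν]
    {β : ℝ × ℝ → ℝ} (hβ : Measurable β) (hβ1 : ∀ q, β q = 1 ∨ β q = -1)
    (hβ0 : ∫ q, β q ∂(ν.prod (gaussianReal 0 1)) = 0) {x v : EuclideanSpace ℝ (Fin n)}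
    (hx : ‖x‖ = 1) (hv : ‖v‖ = 1) {ρ τ : ℝ} (hρ : 0 < ρ) (hxρ : ∀ j, |x j| ≤ ρ) (hτ : 1 ≤ τ)
    (hτm : τ ^ 2 ≤ Ω.card)
    (hρm : Ω.card * (8 * ρ * √(τ + Real.log Ω.card)) ≤ 1 / 4) :
    ((Measure.pi fun _ : Fin n => rademacherLaw).prod
      ((stdGaussian (EuclideanSpace ℝ (Fin n))).prod (Measure.pi fun _ : Ω => ν)))
      {q | 121 * √(Ω.card * (τ + Real.log n)) ≤
        |∑ i : Ω, β (q.2.2 i, inner ℝ q.2.1 (signedShift q.1 x i)) *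
          inner ℝ q.2.1 (signedShift q.1 v i)
          - Ω.card * (inner ℝ x v * ∫ r, β r * r.2 ∂(ν.prod (gaussianReal 0 1)))|}
      ≤ 14 * eexp (-(2 * τ)) := by
  set lam := ∫ r, β r * r.2 ∂(ν.prod (gaussianReal 0 1)) with hlam
  set y := 121 * √(Ω.card * (τ + Real.log n)) with hy
  set ε := 8 * ρ * √(τ + Real.log Ω.card) with hε
  have hΩ : Ω.Nonempty := by
    rw [← Finset.card_pos]
    have : (0 : ℝ) < Ω.card := by nlinarith
    exact_mod_cast this
  have hn1 : (1 : ℝ) ≤ n := by exact_mod_cast NeZero.one_le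
  let B : Set ((Fin n → ℝ) × EuclideanSpace ℝ (Fin n) × (Ω → ℝ)) := {q | y ≤
        |∑ i : Ω, β (q.2.2 i, inner ℝ q.2.1 (signedShift q.1 x i)) *
          inner ℝ q.2.1 (signedShift q.1 v i) - Ω.card * (inner ℝ x v * lam)|}
  have hB : MeasurableSet B := by
    refine measurableSet_le measurable_const ?_
    refine Measurable.norm (f := fun q : (Fin n → ℝ) × EuclideanSpace ℝ (Fin n) × (Ω → ℝ) =>
      ∑ i : Ω, β (q.2.2 i, inner ℝ q.2.1 (signedShift q.1 x i)) *
          inner ℝ q.2.1 (signedShift q.1 v i) - Ω.card * (inner ℝ x v * lam)) ?_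
    refine (Finset.measurable_sum _ fun i _ => Measurable.mul (hβ.comp ?_) ?_).sub_const _
    · refine Measurable.prodMk (by fun_prop) ?_
      exact measurable_inner_signedShift measurable_fst (by fun_prop) x i
    · exact measurable_inner_signedShift measurable_fst (by fun_prop) v i
  let N₁ : Set (Fin n → ℝ) := {ξ | ∃ i j : Ω, i ≠ j ∧ ε
        ≤ |inner ℝ (signedShift ξ x i) (signedShift ξ x j)|}
  let N₂ : Set (Fin n → ℝ) := {ξ | ∃ i j : Ω, i ≠ j ∧ ε
        ≤ |inner ℝ (signedShift ξ x i) (signedShift ξ v j)|}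
  let N₃ : Set (Fin n → ℝ) := {ξ | ¬ ∀ ψ : AddChar (Fin n) ℂ,
    ‖∑ j, ((ξ j * v j : ℝ) : ℂ) * ψ j‖ ^ 2 ≤ 8 * (τ + Real.log (Fintype.card (Fin n)))}
  have hv2 : ∑ j, v j ^ 2 ≤ 1 := by rw [← EuclideanSpace.real_norm_sq_eq, hv]; norm_num
  have hN : (Measure.pi fun _ : Fin n => rademacherLaw) (N₁ ∪ (N₂ ∪ N₃)) ≤ 8 * eexp (-(2 * τ)) := by
    calc _ ≤ 2 * eexp (-(2 * τ)) + (2 * eexp (-(2 * τ)) + 4 * eexp (-(2 * τ))) := by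
          refine (measure_union_le _ _).trans (add_le_add
            (signedShift_correlation_tail_le Ω hΩ hρ hxρ hx.le (by linarith))
            ((measure_union_le _ _).trans (add_le_add
              (signedShift_correlation_tail_le Ω hΩ hρ hxρ hv.le (by linarith))
              (rademacher_fourier_tail_le hv2 (by linarith)))))
      _ = _ := by ring
  change (_ : Measure _) B ≤ _
  rw [Measure.prod_apply hB]
  have hpt : ∀ᵐ ξ ∂(Measure.pi fun _ : Fin n => rademacherLaw),
      ((stdGaussian (EuclideanSpace ℝ (Fin n))).prod (Measure.pi fun _ : Ω => ν))
        (Prod.mk ξ ⁻¹' B) ≤ (N₁ ∪ (N₂ ∪ N₃)).indicator 1 ξ + 6 * eexp (-(2 * τ)) := by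
    filter_upwards [ae_pi_rademacherLaw (Γ := Fin n)] with ξ hξ
    by_cases hg : ξ ∈ N₁ ∪ (N₂ ∪ N₃)
    · rw [Set.indicator_of_mem hg]
      exact prob_le_one.trans le_self_add
    · rw [Set.indicator_of_notMem hg, zero_add]
      simp only [Set.mem_union, not_or] at hg
      obtain ⟨h1, h2, h3⟩ := hg
      simp only [N₁, N₂, N₃, Set.mem_ofPred_eq, not_exists, not_and, not_le, not_not,
        Fintype.card_fin] at h1 h2 h3
      have hcard : (Fintype.card Ω : ℝ) = Ω.card := by simp
      have key := conditional_tail_le_exp hβ hβ1 hβ0 (fun i : Ω => signedShift ξ x i)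
        (fun i : Ω => signedShift ξ v i) (α := inner ℝ x v) (ε := ε) (τ := τ)
        (ℓ := τ + Real.log n) (by positivity) (by rw [hcard]; exact hρm)
        ((abs_real_inner_le_norm x v).trans (by rw [hx, hv, one_mul]))
        (fun i => by
          rw [inner_signedShift_self hξ, real_inner_self_eq_norm_sq, hx, one_pow])
        (fun i j hij => (h1 i j hij).le) (fun i => inner_signedShift_self hξ x v i)
        (fun i j hij => (h2 i j hij).le)
        (fun i => by
          have h := inner_signedShift_self hξ v v i
          rw [real_inner_self_eq_norm_sq, real_inner_self_eq_norm_sq, hv] at h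
          exact abs_le_of_sq_le_sq' (by linarith) zero_le_one |>.2)
        hτ (by linarith [Real.log_nonneg hn1]) (by rw [hcard]; exact hτm)
        (fun z => by
          have h4 := sum_correlation_sq_le h3 z.ofLp
          rw [← EuclideanSpace.real_norm_sq_eq] at h4
          refine le_trans ?_ h4
          simp_rw [inner_signedShift_right]
          rw [Finset.sum_coe_sort Ω fun i => (∑ k, z k * (ξ (k + i) * v (k + i))) ^ 2]
          exact Finset.sum_le_univ_sum_of_nonneg fun i => sq_nonneg _)
      rw [hcard] at key
      exact key
  refine (lintegral_mono_ae hpt).trans ?_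
  rw [lintegral_add_right _ measurable_const]
  calc _ ≤ 8 * eexp (-(2 * τ)) + 6 * eexp (-(2 * τ)) := by
        refine add_le_add ((lintegral_indicator_one_le _).trans hN) ?_
        simp
    _ = _ := by ring

end SignedShift

/-! ### Tail bounds on the given probability space -/

lemma aemeasurable_joint {n : ℕ} {Ω : Finset (Fin n)} {S : Type*} [MeasurableSpace S]
    {P : Measure S} {g ξ : Fin n → S → ℝ} {w : Ω → S → ℝ}
    (hg : ∀ j, AEMeasurable (g j) P) (hξ : ∀ j, AEMeasurable (ξ j) P)
    (hw : ∀ i, AEMeasurable (w i) P) :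
    AEMeasurable (fun s => ((fun j => ξ j s),
      (WithLp.toLp 2 fun j => g j s : EuclideanSpace ℝ (Fin n)), fun i => w i s)) P :=
  (aemeasurable_pi_lambda _ hξ).prodMk (((WithLp.measurable_toLp 2 _).comp_aemeasurable
    (aemeasurable_pi_lambda _ hg)).prodMk (aemeasurable_pi_lambda _ hw))

/-- The joint law of the signs, of the Gaussian vector and of the noise. -/
lemma map_joint_eq_prod {n : ℕ} {Ω : Finset (Fin n)} {ν : Measure ℝ}
    [IsProbabilityMeasure ν] {S : Type*} [MeasurableSpace S] {P : Measure S}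
    [IsProbabilityMeasure P] {g ξ : Fin n → S → ℝ} {w : Ω → S → ℝ}
    (hg : ∀ j, HasLaw (g j) (gaussianReal 0 1) P) (hξ : ∀ j, HasLaw (ξ j) rademacherLaw P)
    (hw : ∀ i, HasLaw (w i) ν P) (hind : iIndepFun (Sum.elim g (Sum.elim ξ w)) P) :
    P.map (fun s => ((fun j => ξ j s),
      (WithLp.toLp 2 fun j => g j s : EuclideanSpace ℝ (Fin n)), fun i => w i s))
      = (Measure.pi fun _ : Fin n => rademacherLaw).prod
        ((stdGaussian (EuclideanSpace ℝ (Fin n))).prod (Measure.pi fun _ : Ω => ν)) := by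
  let κ : Fin n ⊕ (Fin n ⊕ Ω) → Measure ℝ :=
    Sum.elim (fun _ => gaussianReal 0 1) (Sum.elim (fun _ => rademacherLaw) fun _ => ν)
  have hκ : ∀ i, IsProbabilityMeasure (κ i) := by
    rintro (i | i | i)
    · exact inferInstanceAs (IsProbabilityMeasure (gaussianReal 0 1))
    · exact inferInstanceAs (IsProbabilityMeasure rademacherLaw)
    · exact inferInstanceAs (IsProbabilityMeasure ν)
  have hκ2 : ∀ i, IsProbabilityMeasure (κ (Sum.inr i)) := fun i => hκ _
  have hm : ∀ i, AEMeasurable (Sum.elim g (Sum.elim ξ w) i) P := by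
    rintro (i | i | i)
    · exact (hg i).aemeasurable
    · exact (hξ i).aemeasurable
    · exact (hw i).aemeasurable
  have h1 := (iIndepFun_iff_map_fun_eq_pi_map hm).1 hind
  have h2 : (fun i => P.map (Sum.elim g (Sum.elim ξ w) i)) = κ := by
    funext i
    rcases i with i | i | i
    · exact (hg i).map_eq
    · exact (hξ i).map_eq
    · exact (hw i).map_eq
  rw [h2] at h1
  have m1 := measurePreserving_sumPiEquivProdPi (X := fun _ => ℝ) κ
  have m2 := measurePreserving_sumPiEquivProdPi (X := fun _ => ℝ) fun i => κ (Sum.inr i)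
  have mT : MeasurePreserving (WithLp.toLp 2) (Measure.pi fun _ : Fin n => gaussianReal 0 1)
      (stdGaussian (EuclideanSpace ℝ (Fin n))) :=
    ⟨WithLp.measurable_toLp 2 _, map_pi_eq_stdGaussian⟩
  have m3 := ((MeasurePreserving.id (Measure.pi fun _ : Fin n => gaussianReal 0 1)).prod m2).comp m1
  have m4 : MeasurePreserving
      (fun q : (Fin n → ℝ) × (Fin n → ℝ) × (Ω → ℝ) =>
        (q.2.1, (WithLp.toLp 2 q.1 : EuclideanSpace ℝ (Fin n)), q.2.2))
      ((Measure.pi fun _ : Fin n => gaussianReal 0 1).prod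
        ((Measure.pi fun _ : Fin n => rademacherLaw).prod (Measure.pi fun _ : Ω => ν)))
      ((Measure.pi fun _ : Fin n => rademacherLaw).prod
        ((stdGaussian (EuclideanSpace ℝ (Fin n))).prod (Measure.pi fun _ : Ω => ν))) := by
    have a1 := mT.prod (MeasurePreserving.id ((Measure.pi fun _ : Fin n => rademacherLaw).prod
      (Measure.pi fun _ : Ω => ν)))
    have a2 := measurePreserving_prodAssoc (Measure.pi fun _ : Fin n => rademacherLaw)
      (stdGaussian (EuclideanSpace ℝ (Fin n))) (Measure.pi fun _ : Ω => ν)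
    have a3 := (Measure.measurePreserving_swap (μ := stdGaussian (EuclideanSpace ℝ (Fin n)))
      (ν := Measure.pi fun _ : Fin n => rademacherLaw)).prod
        (MeasurePreserving.id (Measure.pi fun _ : Ω => ν))
    have a4 := (measurePreserving_prodAssoc (stdGaussian (EuclideanSpace ℝ (Fin n)))
      (Measure.pi fun _ : Fin n => rademacherLaw) (Measure.pi fun _ : Ω => ν)).symm
    exact a2.comp (a3.comp (a4.comp a1))
  have m5 := m4.comp m3
  rw [← m5.map_eq, ← h1, AEMeasurable.map_map_of_aemeasurable m5.measurable.aemeasurable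
    (aemeasurable_pi_lambda _ hm)]
  rfl

/-- The tail bound on the original probability space, for a unit vector `v`. -/
theorem correlationError_tail_le {n : ℕ} [NeZero n] (Ω : Finset (Fin n)) {θ : ℝ → ℝ → ℝ}
    {ν : Measure ℝ} (hθ : IsObservationModel θ ν) {S : Type*} [MeasurableSpace S] {P : Measure S}
    [IsProbabilityMeasure P] {g ξ : Fin n → S → ℝ} {w : Ω → S → ℝ}
    (hg : ∀ j, HasLaw (g j) (gaussianReal 0 1) P) (hξ : ∀ j, HasLaw (ξ j) rademacherLaw P)
    (hw : ∀ i, HasLaw (w i) ν P) (hind : iIndepFun (Sum.elim g (Sum.elim ξ w)) P)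
    {x v : EuclideanSpace ℝ (Fin n)} (hx : ‖x‖ = 1) (hv : ‖v‖ = 1) {ρ τ : ℝ} (hρ : 0 < ρ)
    (hxρ : ∀ j, |x j| ≤ ρ) (hτ : 1 ≤ τ) (hτm : τ ^ 2 ≤ Ω.card)
    (hρm : Ω.card * (8 * ρ * √(τ + Real.log Ω.card)) ≤ 1 / 4) :
    P {s | 121 * √((τ + Real.log n) / Ω.card) ≤ |correlationError θ ν Ω (fun j => g j s)
      (fun j => ξ j s) (fun i => w i s) x v|} ≤ 14 * eexp (-(2 * τ)) := by
  obtain ⟨hν, β, hβ, hβ1, hθβ, hβ0⟩ := exists_sign_of_isObservationModel hθ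
  have hm0 : (0 : ℝ) < Ω.card := by nlinarith
  have hmean : obsMean θ ν = ∫ r, β r * r.2 ∂(ν.prod (gaussianReal 0 1)) := by
    refine integral_congr_ae ?_
    filter_upwards [Measure.quasiMeasurePreserving_fst.ae hθβ] with q hq
    rw [hq q.2]
  have hξs : ∀ᵐ s ∂P, ∀ j, ξ j s = 1 ∨ ξ j s = -1 := by
    rw [ae_all_iff]
    intro j
    have := ae_rademacherLaw
    rw [← (hξ j).map_eq] at this
    exact ae_of_ae_map (hξ j).aemeasurable this
  have hws : ∀ᵐ s ∂P, ∀ i, ∀ z, θ (w i s) z = β (w i s, z) := by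
    rw [ae_all_iff]
    intro i
    have := hθβ
    rw [← (hw i).map_eq] at this
    exact ae_of_ae_map (hw i).aemeasurable this
  have hjoint := joint_tail_le Ω hβ hβ1 hβ0 hx hv hρ hxρ hτ hτm hρm
  rw [← map_joint_eq_prod hg hξ hw hind] at hjoint
  refine le_trans (measure_mono_ae ?_) ((Measure.le_map_apply (aemeasurable_joint
    (fun j => (hg j).aemeasurable) (fun j => (hξ j).aemeasurable)
    (fun i => (hw i).aemeasurable)) _).trans hjoint)
  filter_upwards [hξs, hws] with s h1 h2 h3
  have h4 : 121 * √((τ + Real.log n) / Ω.card) ≤ |correlationError θ ν Ω (fun j => g j s)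
      (fun j => ξ j s) (fun i => w i s) x v| := h3
  rw [correlationError_eq θ ν Ω _ h1 _ x v hm0.ne', hmean, abs_mul,
    abs_of_pos (by positivity)] at h4
  simp only [h2] at h4
  change 121 * √(Ω.card * (τ + Real.log n)) ≤ _
  have h5 : √(Ω.card * (τ + Real.log n)) = Ω.card * √((τ + Real.log n) / Ω.card) := by
    rw [show (Ω.card : ℝ) * (τ + Real.log n) = Ω.card ^ 2 * ((τ + Real.log n) / Ω.card) by
      field_simp, Real.sqrt_mul (by positivity), Real.sqrt_sq hm0.le]
  have h6 := mul_le_mul_of_nonneg_left h4 hm0.le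
  rw [← mul_assoc (Ω.card : ℝ) (1 / (Ω.card : ℝ)), mul_one_div_cancel hm0.ne', one_mul] at h6
  calc 121 * √(Ω.card * (τ + Real.log n))
      = Ω.card * (121 * √((τ + Real.log n) / Ω.card)) := by rw [h5]; ring
    _ ≤ _ := h6

lemma fourteen_mul_eexp_le {τ : ℝ} (hτ : 3 ≤ τ) : 14 * eexp (-(2 * τ)) ≤ eexp (-τ) := by
  have h1 : (14 : ℝ) ≤ Real.exp τ := by
    have h2 := Real.exp_one_gt_d9
    have h3 : Real.exp 3 = Real.exp 1 ^ 3 := by rw [← Real.exp_nat_mul]; norm_num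
    have h4 : (2.7 : ℝ) ^ 3 ≤ Real.exp 1 ^ 3 := by gcongr; linarith
    have h5 := Real.exp_le_exp.2 hτ
    norm_num at h4
    linarith
  have h2 : (14 : ENNReal) ≤ eexp τ := by
    rw [show (14 : ENNReal) = ENNReal.ofReal 14 by norm_num]
    exact ENNReal.ofReal_le_ofReal h1
  calc 14 * eexp (-(2 * τ)) ≤ eexp τ * eexp (-(2 * τ)) := by gcongr
    _ = eexp (-τ) := by rw [← eexp_add]; congr 1; ring

theorem lemma10 (C₀ C₁ : ℝ) (hC₀ : 0 < C₀) (hC₁ : 0 < C₁) :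
    ∃ c K : ℝ, 0 < c ∧ 0 < K ∧
      ∀ (n m : ℕ) (Ω : Finset (Fin n)) (_ : Ω.card = m)
        (t : ℝ) (_ : 0 < t) (_ : C₀ * (t + Real.log n) ≤ m)
        (x : EuclideanSpace ℝ (Fin n)) (_ : ‖x‖ = 1)
        (ρ : ℝ) (_ : ∀ j, |x j| ≤ ρ) (_ : ρ ≤ C₁ / (m * (t + Real.log m)))
        (θ : ℝ → ℝ → ℝ) (ν : Measure ℝ) (_ : IsObservationModel θ ν)
        (S : Type*) [MeasurableSpace S] (P : Measure S) [IsProbabilityMeasure P]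
        (g ξ : Fin n → S → ℝ) (w : Ω → S → ℝ)
        (_ : ∀ j, HasLaw (g j) (gaussianReal 0 1) P)
        (_ : ∀ j, HasLaw (ξ j) rademacherLaw P)
        (_ : ∀ i, HasLaw (w i) ν P)
        (_ : iIndepFun (Sum.elim g (Sum.elim ξ w)) P)
        (v : EuclideanSpace ℝ (Fin n)),
        1 - Real.exp (-(c * t)) - Real.exp (-(c * √(m : ℝ))) ≤
          P.real {s | |correlationError θ ν Ω (fun j => g j s) (fun j => ξ j s)
              (fun i => w i s) x v| ≤ K * (‖v‖ * √((t + Real.log n) / m))} := by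
  -- Below `M` the claim is made trivial by the choice of `c`; above it `log m` is large enough
  -- for all correlations at nonzero lags to be summable.
  set M : ℝ := max 9 (Real.exp (3 + (64 * C₁) ^ 2)) with hM
  have hM9 : 9 ≤ M := le_max_left _ _
  have hD : 0 < √M + M / C₀ := by positivity
  set c : ℝ := min 1 (Real.log 2 / (√M + M / C₀)) with hc
  have hc0 : 0 < c := lt_min one_pos (div_pos (Real.log_pos one_lt_two) hD)
  refine ⟨c, 242, hc0, by norm_num, ?_⟩
  intro n m Ω hΩ t ht htm x hx ρ hxρ hρ θ ν hθ S _ P _ g ξ w hg hξ hw hind v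
  have hn0 : n ≠ 0 := by
    rintro rfl
    have : x = 0 := Subsingleton.elim _ _
    simp [this] at hx
  have : NeZero n := ⟨hn0⟩
  have hn1 : (1 : ℝ) ≤ n := by exact_mod_cast NeZero.one_le
  have hlogn : 0 ≤ Real.log n := Real.log_nonneg hn1
  have hm0 : (0 : ℝ) < m := lt_of_lt_of_le (by positivity) htm
  rcases lt_or_ge (m : ℝ) M with hmM | hmM
  · have h1 : t ≤ M / C₀ := by
      rw [le_div_iff₀ hC₀]
      nlinarith
    have h2 : √(m : ℝ) ≤ √M := Real.sqrt_le_sqrt hmM.le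
    have h3 : c * (√M + M / C₀) ≤ Real.log 2 := by
      rw [← le_div_iff₀ hD]; exact min_le_right _ _
    have h4 : ∀ r, 0 ≤ r → r ≤ √M + M / C₀ → 1 / 2 ≤ Real.exp (-(c * r)) := by
      intro r _ hr
      have : Real.exp (-Real.log 2) = 1 / 2 := by
        rw [Real.exp_neg, Real.exp_log two_pos]; norm_num
      rw [← this]
      refine Real.exp_le_exp.2 (neg_le_neg ((mul_le_mul_of_nonneg_left hr hc0.le).trans h3))
    have h5 := h4 t ht.le (by linarith [Real.sqrt_nonneg M])
    have h6 := h4 (√(m : ℝ)) (Real.sqrt_nonneg _) (h2.trans (by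
      have : 0 ≤ M / C₀ := by positivity
      linarith))
    exact le_trans (by linarith) measureReal_nonneg
  have hc1 : c ≤ 1 := min_le_left _ _
  have hlogm : 3 + (64 * C₁) ^ 2 ≤ Real.log m := by
    rw [Real.le_log_iff_exp_le hm0]
    exact (le_max_right _ _).trans hmM
  have hlogm3 : 3 ≤ Real.log m := by nlinarith [sq_nonneg (64 * C₁)]
  have hmn : (m : ℝ) ≤ n := by
    rw [← hΩ]
    exact_mod_cast (Finset.card_le_univ Ω).trans_eq (Fintype.card_fin n)
  have hlogmn : Real.log m ≤ Real.log n := Real.log_le_log hm0 hmn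
  have hsqm : 3 ≤ √(m : ℝ) := Real.le_sqrt_of_sq_le (by linarith)
  -- The shift by `3` absorbs the factor `14` of the tail bound.
  set τ := min (t + 3) √(m : ℝ) with hτdef
  have hτ3 : 3 ≤ τ := le_min (by linarith) hsqm
  have hτt : τ ≤ t + 3 := min_le_left _ _
  have hτm : τ ^ 2 ≤ (m : ℝ) := by
    rw [← Real.sq_sqrt hm0.le]
    exact pow_le_pow_left₀ (by linarith) (min_le_right _ _) 2
  have hρ0 : 0 < ρ := by
    by_contra hcon
    have : x = 0 := by
      ext j
      have := (hxρ j).trans (not_lt.1 hcon)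
      simpa using abs_nonpos_iff.1 this
    simp [this] at hx
  have hρm : m * (8 * ρ * √(τ + Real.log m)) ≤ 1 / 4 := by
    set r := √(τ + Real.log m) with hr
    have hr0 : 0 ≤ τ + Real.log m := by linarith
    have hr2 : r ^ 2 = τ + Real.log m := Real.sq_sqrt hr0
    have hr64 : 64 * C₁ ≤ r := Real.le_sqrt_of_sq_le (by linarith)
    have hrpos : 0 < r := lt_of_lt_of_le (by positivity) hr64
    have h1 : ρ * (m * (t + Real.log m)) ≤ C₁ := by
      rwa [le_div_iff₀ (mul_pos hm0 (by linarith))] at hρ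
    have h2 : ρ * m * r ^ 2 ≤ 2 * C₁ := by
      rw [hr2]
      have h3 : τ + Real.log m ≤ 2 * (t + Real.log m) := by linarith
      have h4 : ρ * m * (τ + Real.log m) ≤ ρ * m * (2 * (t + Real.log m)) := by gcongr
      linarith
    have h5 : ρ * m * r * r ≤ 1 / 32 * r := by nlinarith
    have h6 := le_of_mul_le_mul_right h5 hrpos
    linarith
  rcases eq_or_ne v 0 with rfl | hv0
  · have h1 : ∀ s, correlationError θ ν Ω (fun j => g j s) (fun j => ξ j s) (fun i => w i s) x
        (0 : EuclideanSpace ℝ (Fin n)) = 0 := fun s => by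
      simp [correlationError]
    have h2 : P.real {s | |correlationError θ ν Ω (fun j => g j s) (fun j => ξ j s)
        (fun i => w i s) x (0 : EuclideanSpace ℝ (Fin n))|
          ≤ 242 * (‖(0 : EuclideanSpace ℝ (Fin n))‖ * √((t + Real.log n) / m))} = 1 := by
      simp only [h1]
      simp
    rw [h2]
    linarith [Real.exp_pos (-(c * t)), Real.exp_pos (-(c * √(m : ℝ)))]
  have hvn : 0 < ‖v‖ := norm_pos_iff.2 hv0
  set e : EuclideanSpace ℝ (Fin n) := ‖v‖⁻¹ • v with he
  have he1 : ‖e‖ = 1 := by rw [he, norm_smul, norm_inv, norm_norm, inv_mul_cancel₀ hvn.ne']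
  have hve : v = ‖v‖ • e := by rw [he, smul_smul, mul_inv_cancel₀ hvn.ne', one_smul]
  have htail := (correlationError_tail_le Ω hθ hg hξ hw hind hx he1 hρ0 hxρ (by linarith)
    (by rw [hΩ]; exact hτm) (by rw [hΩ]; exact hρm)).trans (fourteen_mul_eexp_le hτ3)
  rw [hΩ] at htail
  set A := {s | |correlationError θ ν Ω (fun j => g j s) (fun j => ξ j s)
    (fun i => w i s) x v| ≤ 242 * (‖v‖ * √((t + Real.log n) / m))} with hA
  have hsub : Aᶜ ⊆ {s | 121 * √((τ + Real.log n) / m) ≤ |correlationError θ ν Ω (fun j => g j s)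
      (fun j => ξ j s) (fun i => w i s) x e|} := by
    intro s hs
    have h1 : 242 * (‖v‖ * √((t + Real.log n) / m)) < |correlationError θ ν Ω (fun j => g j s)
      (fun j => ξ j s) (fun i => w i s) x v| := not_le.1 hs
    have h2 : correlationError θ ν Ω (fun j => g j s) (fun j => ξ j s) (fun i => w i s) x v
        = ‖v‖ * correlationError θ ν Ω (fun j => g j s) (fun j => ξ j s) (fun i => w i s) x e := by
      conv_lhs => rw [hve]
      exact correlationError_smul θ ν Ω _ _ _ x e ‖v‖
    rw [h2, abs_mul, abs_norm] at h1
    have h3 : 242 * √((t + Real.log n) / m) < |correlationError θ ν Ω (fun j => g j s)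
        (fun j => ξ j s) (fun i => w i s) x e| := by
      refine lt_of_mul_lt_mul_left ?_ hvn.le
      linarith
    have h4 : √((τ + Real.log n) / m) ≤ 2 * √((t + Real.log n) / m) := by
      have h5 : (τ + Real.log n) / m ≤ 2 ^ 2 * ((t + Real.log n) / m) := by
        rw [← mul_div_assoc]
        gcongr
        linarith
      refine (Real.sqrt_le_sqrt h5).trans_eq ?_
      rw [Real.sqrt_mul (by norm_num), Real.sqrt_sq (by norm_num)]
    change 121 * √((τ + Real.log n) / m) ≤ _
    linarith
  have hAc : P.real Aᶜ ≤ Real.exp (-τ) := by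
    refine ENNReal.toReal_le_of_le_ofReal (Real.exp_nonneg _) ?_
    exact (measure_mono hsub).trans htail
  have hone : 1 ≤ P.real A + P.real Aᶜ := by
    have := measureReal_union_le (μ := P) A Aᶜ
    rwa [Set.union_compl_self, probReal_univ] at this
  have hexp : Real.exp (-τ) ≤ Real.exp (-(c * t)) + Real.exp (-(c * √(m : ℝ))) := by
    rcases min_choice (t + 3) √(m : ℝ) with h | h
    · have : Real.exp (-τ) ≤ Real.exp (-(c * t)) := by
        refine Real.exp_le_exp.2 ?_
        rw [hτdef, h]
        nlinarith
      linarith [Real.exp_pos (-(c * √(m : ℝ)))]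
    · have : Real.exp (-τ) ≤ Real.exp (-(c * √(m : ℝ))) := by
        refine Real.exp_le_exp.2 ?_
        rw [hτdef, h]
        nlinarith
      linarith [Real.exp_pos (-(c * t))]
  linarith
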